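/- Rings are associative and unital. For ring homomorphisms $\alpha,\beta:A\to B$ let $\mathrm{Hom}(\alpha,\beta)=\{t\in B\mid t\alpha(a)=\beta(a)t\ \forall a\in A\}$ and $\mathrm{End}(\alpha)=\mathrm{Hom}(\alpha,\alpha)$. Write $\alpha\le\beta$ if there are finitely many $b_i\in\mathrm{Hom}(\alpha,\beta)$, $a_i\in\mathrm{Hom}(\beta,\alpha)$ with $\sum_i a_ib_i=1_B$ (a direct summand diagram $\alpha\xrightarrow{b_i}\beta\xrightarrow{a_i}\alpha$). Let $B$ be a ring and $\sigma:B\to B$ a ring endomorphism with $\sigma\sigma\le\sigma$ and $\mathrm{id}_B\le\sigma$. Let $\mathcal C_\sigma$ be the category of all endomorphisms $\alpha$ of $B$ with $\alpha\le\sigma$, with arrows $\mathrm{Hom}(\alpha,\beta)$, monoidal under composition. Suppose that $\sigma$ has a left dual $\sigma^l\in\mathcal C_\sigma$, i.e. there are $e\in\mathrm{Hom}(\sigma^l\sigma,\mathrm{id}_B)$ and $m\in\mathrm{Hom}(\mathrm{id}_B,\sigma\sigma^l)$ with $\sigma(e)m=1$ and $e\,\sigma^l(m)=1$. Put $S=\mathrm{End}(\sigma)$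 and $r^l=e\,\sigma^l(rm)$ for $r\in S$. Let $F:\mathcal C_\sigma\to\mathsf{Ab}$ be the monoidal functor $F(\alpha)=\mathrm{Hom}(\sigma,\sigma\alpha)$, $F(t)x=\sigma(t)x$, $F_{\alpha,\beta}(x\otimes y)=xy$, $F_0(1)=1$. Let $A$ be its field algebra: the quotient of $\bigoplus_{\alpha\in\mathcal C_\sigma}B\otimes_{\mathbb Z}F(\alpha)$ by the relations $bt\otimes_\alpha x=b\otimes_\beta F(t)x$ ($b\in B$, $t\in\mathrm{Hom}(\alpha,\beta)$, $x\in F(\alpha)$), with product $(b\otimes_\alpha x)(b'\otimes_\beta x')=b\alpha(b')\otimes_{\alpha\beta}xx'$ and unit $1\otimes_{\mathrm{id}}1$, and let $\rho_F:B\to A$, $b\mapsto b\otimes_{\mathrm{id}}1$. Then: (1) $\rho_F$ is a split $B$-ring: there is a $B$-bimodule map $E:A\to B$ with $E(1)=1$. (2) The ring $\mathcal H=\mathrm{End}(\sigma\sigma^l)$ is a left bialgebroid over $S$ with source $s(r)=r$, target $t(r)=\sigma(r^l)$, counit $\varepsilon(h)=\sigma(e)hm$ and comultiplication $$\Delta(h)=\sum_i\sigma(e)\,h\,\sigma\big(e\,\sigma^l(q_im)\big)\otimes_S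 p_i\,\sigma\sigma^l(m)$$ for any direct summand diagram $\sigma\sigma^l\sigma\xrightarrow{p_i}\sigma\xrightarrow{q_i}\sigma\sigma^l\sigma$. (3) $\rho_F$ is right $\mathcal H$-Galois: with the $S$-ring structure $r\mapsto 1\otimes_{\mathrm{id}}r$ and the coaction $\delta:A\to A\otimes_S\mathcal H$, written $\delta(a)=a_{(0)}\otimes a_{(1)}$, $$\delta(b\otimes_\alpha x)=\sum_i(b\otimes_\alpha x_i)\otimes_S f_i\,\sigma\big(e\,\sigma^l(xm)\big)$$ for any direct summand diagram $\sigma\alpha\xrightarrow{f_i}\sigma\xrightarrow{x_i}\sigma\alpha$, $A$ is a right $\mathcal H$-comodule algebra (in the convention $\delta(aa')=a_{(0)}a'_{(0)}\otimes a'_{(1)}a_{(1)}$ for left bialgebroids, where $S$ acts on $A$ from the right by multiplication and on $\mathcal H$ from the left through $s$); its coinvariants $\{a\mid\delta(a)=a\otimes1\}$ are exactly $\rho_F(B)$, and the map $A\otimes_BA\to A\otimes_S\mathcal H$, $a\otimes a'\mapsto aa'_{(0)}\otimes a'_{(1)}$, is well defined and bijective. (4) $\mathcal H$ is a split $S$-ring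 via $s$: there is an $S$-bimodule map $E':\mathcal H\to S$ with $E'(1)=1$, where $S$ acts on $\mathcal H$ by $r\cdot h\cdot r'=s(r)hs(r')$. -/

import Mathlib

open scoped TensorProduct DirectSum BigOperators
open MulOpposite

universe u v w z

namespace FieldAlg

/-! ### The 2-category of rings

Objects are rings, 1-cells `A → B` are ring homomorphisms, 2-cells `α → β` are the elements `t` of
`B` with `t α(a) = β(a) t`; vertical composition is multiplication in `B`, horizontal composition
of 1-cells is composition, and of 2-cells is `t ⊗ s = t α(s)`. -/

section TwoCells

variable {A : Type u} {B : Type v} [Ring A] [Ring B]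

/-- The group `Hom(α, β)` of intertwiners. -/
def Hom (α β : A →+* B) : AddSubgroup B where
  carrier := {t | ∀ a, t * α a = β a * t}
  zero_mem' := by intro a; simp
  add_mem' := by intro x y hx hy a; rw [add_mul, mul_add, hx a, hy a]
  neg_mem' := by intro x hx a; rw [neg_mul, mul_neg, hx a]

theorem mem_Hom {α β : A →+* B} {t : B} : t ∈ Hom α β ↔ ∀ a, t * α a = β a * t := Iff.rfl

/-- The ring `End(σ) = Hom(σ, σ)` of self-intertwiners. -/
def End (σ : A →+* B) : Subring B where
  carrier := {t | ∀ a, t * σ a = σ a * t}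
  zero_mem' := by intro a; simp
  one_mem' := by intro a; simp
  add_mem' := by intro x y hx hy a; rw [add_mul, mul_add, hx a, hy a]
  neg_mem' := by intro x hx a; rw [neg_mul, mul_neg, hx a]
  mul_mem' := by intro x y hx hy a; rw [mul_assoc, hy a, ← mul_assoc, hx a, mul_assoc]

theorem mem_End {σ : A →+* B} {t : B} : t ∈ End σ ↔ ∀ a, t * σ a = σ a * t := Iff.rfl

/-- The coherence 2-cell `1_B : α → β` between equal 1-cells; for `h = rfl` the identity. -/
def Hom.ofEq {α β : A →+* B} (h : α = β) : Hom α β := ⟨1, by intro a; simp [h]⟩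

/-- Vertical composition. -/
def Hom.vcomp {α β γ : A →+* B} (s : Hom β γ) (t : Hom α β) : Hom α γ :=
  ⟨(s : B) * t, by
    intro a
    rw [mul_assoc, t.2 a, ← mul_assoc, s.2 a, mul_assoc]⟩

/-- `ρ → σ → ρ` (with components `b i : ρ → σ` and `a i : σ → ρ`) is a direct summand diagram. -/
structure IsSummandDiagram (ρ σ : A →+* B) {ι : Type} [Fintype ι] (b a : ι → B) : Prop where
  left : ∀ i, b i ∈ Hom ρ σ
  right : ∀ i, a i ∈ Hom σ ρ
  sum_eq : ∑ i, a i * b i = 1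

/-- The preorder `ρ ≤ σ` on parallel 1-cells. -/
def Le (ρ σ : A →+* B) : Prop :=
  ∃ (ι : Type) (_ : Fintype ι) (b a : ι → B), IsSummandDiagram ρ σ b a

theorem Le.trans {ρ σ τ : A →+* B} (h₁ : Le ρ σ) (h₂ : Le σ τ) : Le ρ τ := by
  obtain ⟨ι, _, b, a, h⟩ := h₁
  obtain ⟨κ, _, d, c, k⟩ := h₂
  refine ⟨ι × κ, inferInstance, fun p => d p.2 * b p.1, fun p => a p.1 * c p.2, ?_, ?_, ?_⟩
  · intro p x
    rw [mul_assoc, h.left p.1 x, ← mul_assoc, k.left p.2 x, mul_assoc]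
  · intro p x
    rw [mul_assoc, k.right p.2 x, ← mul_assoc, h.right p.1 x, mul_assoc]
  · rw [Fintype.sum_prod_type]
    have : ∀ i j, a i * c j * (d j * b i) = a i * ((c j * d j) * b i) := by
      intro i j; simp only [mul_assoc]
    simp only [this, ← Finset.mul_sum, ← Finset.sum_mul, k.sum_eq, one_mul, h.sum_eq]

/-- An adjunction `l ⊣ ρ` with counit `e : l ρ → id` and unit `m : id → ρ l`. -/
structure Adj (l : A →+* B) (ρ : B →+* A) where
  e : B
  m : A
  e_mem : e ∈ Hom (l.comp ρ) (RingHom.id B)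
  m_mem : m ∈ Hom (RingHom.id A) (ρ.comp l)
  right_triangle : ρ e * m = 1
  left_triangle : e * l m = 1

/-- `r^l = e l(r) l(m)`, the image of `r : ρ → ρ` under `Hom(ρ, ρ) → Hom(l, l)`. -/
def Adj.dual {l : A →+* B} {ρ : B →+* A} (adj : Adj l ρ) (r : A) : B :=
  adj.e * l r * l adj.m

end TwoCells

section Preorder

variable {B : Type u} [Ring B]

/-- Horizontal composition of 2-cells between endomorphisms, `t ⊗ s = t α(s) : αβ → α'β'`. -/
def Hom.hcomp {α α' β β' : B →+* B} (t : Hom α α') (s : Hom β β') : Hom (α * β) (α' * β') :=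
  ⟨(t : B) * α s, by
    intro b
    change (t : B) * α s * α (β b) = α' (β' b) * (t * α s)
    rw [mul_assoc, ← map_mul, s.2 b, map_mul, ← mul_assoc, t.2 (β' b), mul_assoc]⟩

theorem Le.comp {α α' β β' : B →+* B} (h₁ : Le α α') (h₂ : Le β β') :
    Le (α * β) (α' * β') := by
  obtain ⟨ι, _, b, a, h⟩ := h₁
  obtain ⟨κ, _, d, c, k⟩ := h₂
  refine ⟨ι × κ, inferInstance, fun p => b p.1 * α (d p.2), fun p => α (c p.2) * a p.1,
    ?_, ?_, ?_⟩
  · intro p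
    exact (Hom.hcomp ⟨b p.1, h.left p.1⟩ ⟨d p.2, k.left p.2⟩).2
  · intro p x
    change α (c p.2) * a p.1 * α' (β' x) = α (β x) * (α (c p.2) * a p.1)
    rw [mul_assoc, h.right p.1 (β' x), ← mul_assoc, ← map_mul, k.right p.2 x, map_mul, mul_assoc]
  · rw [Fintype.sum_prod_type_right]
    have : ∀ i j, α (c j) * a i * (b i * α (d j)) = α (c j) * ((a i * b i) * α (d j)) := by
      intro i j; simp only [mul_assoc]
    simp only [this, ← Finset.mul_sum, ← Finset.sum_mul, h.sum_eq, one_mul, ← map_mul, ← map_sum,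
      k.sum_eq, map_one]

/-- `σ` is a monoid in the monoidal preorder of endomorphisms of `B`: `σσ ≤ σ` and `id ≤ σ`. -/
structure IsMonoid (σ : B →+* B) : Prop where
  mul_le : Le (σ * σ) σ
  one_le : Le 1 σ

/-- The full monoidal subcategory `C_σ` of all `α` with `α ≤ σ`. -/
def fusionCat (σ : B →+* B) (hσ : IsMonoid σ) : Submonoid (B →+* B) where
  carrier := {α | Le α σ}
  one_mem' := hσ.one_le
  mul_mem' := fun ha hb => (Le.comp ha hb).trans hσ.mul_le

end Preorder

/-! ### Monoidal functors and the field algebra -/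

/-- An additive (lax) monoidal functor `F : C → Ab` on the full monoidal subcategory `C` of
`Ring(B, B)` with set of objects a given submonoid of endomorphisms. The category is strict; its
coherence isomorphisms are the 2-cells `1_B`. -/
structure FiberFunctor {B : Type u} [Ring B] (C : Submonoid (B →+* B)) where
  obj : C → Type v
  [grp : ∀ α, AddCommGroup (obj α)]
  map : ∀ {α β : C}, Hom (α : B →+* B) β →+ obj α →+ obj β
  map_id : ∀ (α : C) (x : obj α), map (Hom.ofEq rfl : Hom (α : B →+* B) α) x = x
  map_comp : ∀ {α β γ : C} (s : Hom (β : B →+* B) γ) (t : Hom (α : B →+* B) β) (x : obj α),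
    map (Hom.vcomp s t) x = map s (map t x)
  mu : ∀ {α β : C}, obj α →+ obj β →+ obj (α * β)
  unit : obj 1
  mu_natural : ∀ {α α' β β' : C} (t : Hom (α : B →+* B) α') (s : Hom (β : B →+* B) β')
    (x : obj α) (y : obj β),
    mu (map t x) (map s y) = map (α := α * β) (β := α' * β') (Hom.hcomp t s) (mu x y)
  mu_assoc : ∀ {α β γ : C} (x : obj α) (y : obj β) (z : obj γ),
    map (Hom.ofEq (congrArg Subtype.val (mul_assoc α β γ))) (mu (mu x y) z) = mu x (mu y z)
  unit_mu : ∀ {α : C} (x : obj α),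
    map (Hom.ofEq (congrArg Subtype.val (one_mul α))) (mu unit x) = x
  mu_unit : ∀ {α : C} (x : obj α),
    map (Hom.ofEq (congrArg Subtype.val (mul_one α))) (mu x unit) = x

attribute [instance] FiberFunctor.grp

section FieldAlgebra

open Classical in
/-- The relations `b t ⊗ x = b ⊗ F(t) x` in `⨁_α B ⊗ F(α)`. -/
def fieldRel {B : Type u} [Ring B] {C : Submonoid (B →+* B)} (F : FiberFunctor.{u, v} C) :
    AddSubgroup (⨁ α : C, B ⊗[ℤ] F.obj α) :=
  AddSubgroup.closure {y | ∃ (α β : C) (t : Hom (α : B →+* B) β) (b : B) (x : F.obj α),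
    y = DirectSum.of (fun α : C => B ⊗[ℤ] F.obj α) α ((b * t) ⊗ₜ[ℤ] x)
      - DirectSum.of (fun α : C => B ⊗[ℤ] F.obj α) β (b ⊗ₜ[ℤ] F.map t x)}

/-- The tensor product `Υ ⊗_C F` of the basic presheaf `Υ` (`Υ(α) = B`, with `Υ(t)` right
multiplication by `t`) with `F`: the coequalizer of `L` and `R`. -/
def FieldAlgebra {B : Type u} [Ring B] {C : Submonoid (B →+* B)} (F : FiberFunctor.{u, v} C) :
    Type (max u v) :=
  (⨁ α : C, B ⊗[ℤ] F.obj α) ⧸ fieldRel F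

namespace FieldAlgebra

variable {B : Type u} [Ring B] {C : Submonoid (B →+* B)} (F : FiberFunctor.{u, v} C)

instance : AddCommGroup (FieldAlgebra F) :=
  inferInstanceAs (AddCommGroup ((⨁ α : C, B ⊗[ℤ] F.obj α) ⧸ fieldRel F))

open Classical in
/-- The element `b ⊗_α x` of the field algebra, as a biadditive map. -/
noncomputable def word (α : C) : B →+ F.obj α →+ FieldAlgebra F :=
  AddMonoidHom.mk' (fun b => AddMonoidHom.mk'
    (fun x => (QuotientAddGroup.mk (DirectSum.of (fun α : C => B ⊗[ℤ] F.obj α) α (b ⊗ₜ[ℤ] x)) :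
      (⨁ α : C, B ⊗[ℤ] F.obj α) ⧸ fieldRel F))
    (by intro x y; rw [TensorProduct.tmul_add, map_add]; rfl))
    (by
      intro b b'; ext x
      change (QuotientAddGroup.mk _ : (⨁ α : C, B ⊗[ℤ] F.obj α) ⧸ fieldRel F) = _
      rw [TensorProduct.add_tmul, map_add]; rfl)

variable {F}

theorem word_rel {α β : C} (t : Hom (α : B →+* B) β) (b : B) (x : F.obj α) :
    word F α (b * t) x = word F β b (F.map t x) := by
  refine (QuotientAddGroup.eq_iff_sub_mem).2 ?_
  exact AddSubgroup.subset_closure ⟨α, β, t, b, x, rfl⟩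

theorem word_ofEq {α β : C} (h : (α : B →+* B) = β) (b : B) (x : F.obj α) :
    word F β b (F.map (Hom.ofEq h) x) = word F α b x := by
  rw [← word_rel]
  simp [Hom.ofEq]

open Classical in
/-- The universal property of the coequalizer. -/
noncomputable def lift {P : Type w} [AddCommGroup P] (f : ∀ α : C, B →+ F.obj α →+ P)
    (hf : ∀ (α β : C) (t : Hom (α : B →+* B) β) (b : B) (x : F.obj α),
      f α (b * t) x = f β b (F.map t x)) : FieldAlgebra F →+ P :=
  QuotientAddGroup.lift (fieldRel F)
    (DirectSum.toAddMonoid fun α => TensorProduct.liftAddHom (f α)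
      (by intro r b x; rw [map_zsmul, map_zsmul, AddMonoidHom.zsmul_apply]))
    (by
      refine (AddSubgroup.closure_le _).2 ?_
      rintro _ ⟨α, β, t, b, x, rfl⟩
      change _ = _
      simp [hf])

theorem lift_word {P : Type w} [AddCommGroup P] (f : ∀ α : C, B →+ F.obj α →+ P)
    (hf : ∀ (α β : C) (t : Hom (α : B →+* B) β) (b : B) (x : F.obj α),
      f α (b * t) x = f β b (F.map t x)) (α : C) (b : B) (x : F.obj α) :
    lift f hf (word F α b x) = f α b x := by
  classical
  exact DirectSum.toAddMonoid_of (β := fun α : C => B ⊗[ℤ] F.obj α)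
    (fun α => TensorProduct.liftAddHom (f α)
      (by intro r b x; rw [map_zsmul, map_zsmul, AddMonoidHom.zsmul_apply])) α (b ⊗ₜ[ℤ] x)

theorem induction {p : FieldAlgebra F → Prop} (hz : p 0)
    (hw : ∀ α b x, p (word F α b x)) (ha : ∀ y z, p y → p z → p (y + z)) (y : FieldAlgebra F) :
    p y := by
  classical
  obtain ⟨y, rfl⟩ := QuotientAddGroup.mk_surjective y
  induction y using DirectSum.induction_on with
  | zero => exact hz
  | of α y =>
    induction y using TensorProduct.induction_on with
    | zero => rw [map_zero]; exact hz
    | tmul b x => exact hw α b x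
    | add y z hy hz => rw [map_add]; exact ha _ _ hy hz
  | add y z hy hz => exact ha _ _ hy hz

variable (F) in
/-- Multiplication by `b ⊗_α x` from the left. -/
noncomputable def lmulWord (α : C) (b : B) (x : F.obj α) : FieldAlgebra F →+ FieldAlgebra F :=
  lift (fun β => AddMonoidHom.mk' (fun b' => (word F (α * β) (b * α.1 b')).comp (F.mu x))
      (by intro b₁ b₂; ext y; simp [mul_add]))
    (by
      intro β β' t b' y
      change word F (α * β) (b * α.1 (b' * t)) (F.mu x y)
        = word F (α * β') (b * α.1 b') (F.mu x (F.map t y))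
      have h := F.mu_natural (Hom.ofEq rfl : Hom (α : B →+* B) α) t x y
      rw [F.map_id] at h
      rw [h, ← word_rel]
      simp [Hom.hcomp, Hom.ofEq, mul_assoc])

theorem lmulWord_word (α β : C) (b b' : B) (x : F.obj α) (y : F.obj β) :
    lmulWord F α b x (word F β b' y) = word F (α * β) (b * α.1 b') (F.mu x y) :=
  lift_word _ _ _ _ _

theorem hom_ext {P : Type w} [AddCommGroup P] {f g : FieldAlgebra F →+ P}
    (h : ∀ α b x, f (word F α b x) = g (word F α b x)) : f = g := by
  ext y
  induction y using FieldAlgebra.induction with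
  | hz => simp
  | hw α b x => exact h α b x
  | ha y z hy hz => rw [map_add, map_add, hy, hz]

variable (F) in
/-- The multiplication `(b ⊗_α x)(b' ⊗_β x') = b α(b') ⊗_{αβ} F_{α,β}(x ⊗ x')`. -/
noncomputable def mulHom : FieldAlgebra F →+ FieldAlgebra F →+ FieldAlgebra F :=
  lift (fun α => AddMonoidHom.mk' (fun b => AddMonoidHom.mk' (fun x => lmulWord F α b x)
      (by intro x y; refine hom_ext fun β b' z => ?_; simp [lmulWord_word]))
      (by intro b₁ b₂; ext x : 1; refine hom_ext fun β b' z => ?_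
          simp [lmulWord_word, add_mul]))
    (by
      intro α α' t b x
      refine hom_ext fun β b' y => ?_
      change lmulWord F α (b * t) x _ = lmulWord F α' b (F.map t x) _
      rw [lmulWord_word, lmulWord_word]
      have h := F.mu_natural t (Hom.ofEq rfl : Hom (β : B →+* B) β) x y
      rw [F.map_id] at h
      rw [h, ← word_rel]
      simp [Hom.hcomp, Hom.ofEq, mul_assoc, t.2 b'])

theorem mulHom_word (α β : C) (b b' : B) (x : F.obj α) (y : F.obj β) :
    mulHom F (word F α b x) (word F β b' y) = word F (α * β) (b * α.1 b') (F.mu x y) := by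
  rw [mulHom, lift_word]
  exact lmulWord_word _ _ _ _ _ _

/-- The ring structure of the field algebra, with unit `1_B ⊗_ι F_0(1)`. -/
noncomputable instance : Ring (FieldAlgebra F) :=
  { (inferInstance : AddCommGroup (FieldAlgebra F)) with
    mul := fun y z => mulHom F y z
    one := word F 1 1 F.unit
    left_distrib := fun y z w => (mulHom F y).map_add z w
    right_distrib := fun y z w => by
      change mulHom F (y + z) w = mulHom F y w + mulHom F z w
      rw [map_add]; rfl
    zero_mul := fun y => by
      change mulHom F 0 y = 0
      rw [map_zero]; rfl
    mul_zero := fun y => (mulHom F y).map_zero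
    one_mul := fun y => by
      change mulHom F (word F 1 1 F.unit) y = y
      induction y using FieldAlgebra.induction with
      | hz => exact map_zero _
      | hw α b x =>
        rw [mulHom_word, ← word_ofEq (congrArg Subtype.val (one_mul α)), F.unit_mu]
        simp
      | ha y z hy hz => rw [map_add, hy, hz]
    mul_one := fun y => by
      change mulHom F y (word F 1 1 F.unit) = y
      induction y using FieldAlgebra.induction with
      | hz => rw [map_zero]; rfl
      | hw α b x =>
        rw [mulHom_word, ← word_ofEq (congrArg Subtype.val (mul_one α)), F.mu_unit]
        simp
      | ha y z hy hz => rw [map_add, AddMonoidHom.add_apply, hy, hz]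
    mul_assoc := fun y z w => by
      change mulHom F (mulHom F y z) w = mulHom F y (mulHom F z w)
      induction y using FieldAlgebra.induction with
      | hz => simp
      | ha y y' hy hy' =>
        rw [map_add, AddMonoidHom.add_apply, map_add, AddMonoidHom.add_apply,
          AddMonoidHom.add_apply, hy, hy']
      | hw α b x =>
        induction z using FieldAlgebra.induction with
        | hz => simp
        | ha z z' hz hz' =>
          rw [map_add, map_add, AddMonoidHom.add_apply, map_add, AddMonoidHom.add_apply, map_add,
            hz, hz']
        | hw β b' x' =>
          induction w using FieldAlgebra.induction with
          | hz => simp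
          | ha w w' hw hw' => rw [map_add, map_add, map_add, hw, hw']
          | hw γ b'' x'' =>
            rw [mulHom_word, mulHom_word, mulHom_word, mulHom_word,
              ← word_ofEq (congrArg Subtype.val (mul_assoc α β γ)), F.mu_assoc]
            congr 2
            simp [mul_assoc] }

theorem word_mul_word (α β : C) (b b' : B) (x : F.obj α) (y : F.obj β) :
    word F α b x * word F β b' y = word F (α * β) (b * α.1 b') (F.mu x y) :=
  mulHom_word _ _ _ _ _ _

theorem one_def : (1 : FieldAlgebra F) = word F 1 1 F.unit := rfl

variable (F) in
/-- The field algebra extension `ρ_F : B → Υ ⊗_C F`, `b ↦ b ⊗_ι F_0(1)`. -/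
noncomputable def extension : B →+* FieldAlgebra F where
  toFun b := word F 1 b F.unit
  map_one' := rfl
  map_zero' := by simp
  map_add' := by simp
  map_mul' := by
    intro b b'
    rw [word_mul_word, ← word_ofEq (congrArg Subtype.val (one_mul (1 : C))), F.unit_mu]
    simp

end FieldAlgebra

/-- The functor `α ↦ Hom(ρ, ρα)` of an extension `ρ : B → A`, restricted to `C`; a 2-cell `t` acts
by left multiplication with `ρ(t)`, the monoidal structure is multiplication in `A`. -/
def homFunctor {B : Type u} [Ring B] {A : Type v} [Ring A] (ρ : B →+* A)
    (C : Submonoid (B →+* B)) : FiberFunctor.{u, v} C where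
  obj α := Hom ρ (ρ.comp (α : B →+* B))
  map {α β} := AddMonoidHom.mk' (fun t => AddMonoidHom.mk'
      (fun x => ⟨ρ t * (x : A), by
        intro b
        change ρ t * (x : A) * ρ b = ρ ((β : B →+* B) b) * (ρ t * x)
        have hx : (x : A) * ρ b = ρ ((α : B →+* B) b) * x := x.2 b
        rw [mul_assoc, hx, ← mul_assoc, ← map_mul, t.2 b, map_mul, mul_assoc]⟩)
      (by intro x y; ext; simp [mul_add]))
    (by intro s t; ext x; simp [add_mul])
  map_id := by intro α x; ext; simp [Hom.ofEq]
  map_comp := by intro α β γ s t x; ext; simp [Hom.vcomp, mul_assoc]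
  mu {α β} := AddMonoidHom.mk' (fun x => AddMonoidHom.mk'
      (fun y => ⟨(x : A) * (y : A), by
        intro b
        change (x : A) * (y : A) * ρ b = ρ ((α : B →+* B) ((β : B →+* B) b)) * (x * y)
        have hx := x.2 ((β : B →+* B) b)
        have hy := y.2 b
        simp only [RingHom.comp_apply] at hx hy
        rw [mul_assoc, hy, ← mul_assoc, hx, mul_assoc]⟩)
      (by intro x y; ext; simp [mul_add]))
    (by intro x y; ext z; simp [add_mul])
  unit := ⟨1, by intro b; simp⟩
  mu_natural := by
    intro α α' β β' t s x y
    ext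
    have hx := x.2 (s : B)
    simp only [RingHom.comp_apply] at hx
    simp only [AddMonoidHom.mk'_apply, Hom.hcomp, map_mul, mul_assoc]
    rw [← mul_assoc (x : A), hx, mul_assoc]
  mu_assoc := by intro α β γ x y z; ext; simp [Hom.ofEq, mul_assoc]
  unit_mu := by intro α x; ext; simp [Hom.ofEq]
  mu_unit := by intro α x; ext; simp [Hom.ofEq]

/-- An intertwiner `x : ρ → ρα` as an element of `F(α)` for `F = Hom(ρ, ρ _)`. -/
def toObj {B : Type u} [Ring B] {A : Type v} [Ring A] {ρ : B →+* A}
    {C : Submonoid (B →+* B)} (α : C) (x : Hom ρ (ρ.comp (α : B →+* B))) :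
    (homFunctor ρ C).obj α := x

/-- The ring homomorphism `π_F : F(ι) = End(ρ) → Υ ⊗_C F`, `r ↦ 1_B ⊗_ι r`, for
`F = Hom(ρ, ρ _)`. -/
noncomputable def baseMap {B : Type u} [Ring B] {A : Type v} [Ring A] (ρ : B →+* A)
    (C : Submonoid (B →+* B)) : End ρ →+* FieldAlgebra (homFunctor ρ C) where
  toFun r := FieldAlgebra.word (homFunctor ρ C) 1 1 (toObj 1 ⟨(r : A), mem_Hom.2 (mem_End.1 r.2)⟩)
  map_one' := rfl
  map_zero' := (FieldAlgebra.word (homFunctor ρ C) 1 1).map_zero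
  map_add' r r' := (FieldAlgebra.word (homFunctor ρ C) 1 1).map_add
    (toObj 1 ⟨(r : A), mem_Hom.2 (mem_End.1 r.2)⟩)
    (toObj 1 ⟨(r' : A), mem_Hom.2 (mem_End.1 r'.2)⟩)
  map_mul' := by
    intro r r'
    rw [FieldAlgebra.word_mul_word]
    refine Eq.trans ?_ (FieldAlgebra.word_ofEq (F := homFunctor ρ C)
      (congrArg Subtype.val (one_mul (1 : C))) _ _)
    have h1 : (1 : B) * ((1 : C) : B →+* B) 1 = 1 := by simp
    rw [h1]
    congr 1
    apply Subtype.ext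
    change (r : A) * r' = ρ 1 * (r * r')
    rw [map_one, one_mul]

end FieldAlgebra

/-! ### Tensor products over noncommutative rings -/

section BalancedTensor

variable {R : Type u} {R' : Type u} {M : Type v} {N : Type w} {P : Type z}
  [AddCommGroup M] [AddCommGroup N] [AddCommGroup P]

/-- The subgroup generated by all `m r ⊗ n - m ⊗ r n`. -/
def balRel (ra : M → R → M) (la : R → N → N) : AddSubgroup (M ⊗[ℤ] N) :=
  AddSubgroup.closure {y | ∃ m r n, y = ra m r ⊗ₜ[ℤ] n - m ⊗ₜ[ℤ] la r n}

/-- `M ⊗_R N` for the right action `ra` of `R` on `M` and the left action `la` of `R` on `N`. -/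
def BalTensor (ra : M → R → M) (la : R → N → N) : Type (max v w) :=
  (M ⊗[ℤ] N) ⧸ balRel ra la

/-- The subgroup generated by the two kinds of relations defining `M ⊗_R N ⊗_R' P`. -/
def balRel₃ (ra : M → R → M) (la : R → N → N) (ra' : N → R' → N) (la' : R' → P → P) :
    AddSubgroup (M ⊗[ℤ] (N ⊗[ℤ] P)) :=
  AddSubgroup.closure
    ({y | ∃ m r n p, y = ra m r ⊗ₜ[ℤ] (n ⊗ₜ[ℤ] p) - m ⊗ₜ[ℤ] (la r n ⊗ₜ[ℤ] p)} ∪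
     {y | ∃ m n r p, y = m ⊗ₜ[ℤ] (ra' n r ⊗ₜ[ℤ] p) - m ⊗ₜ[ℤ] (n ⊗ₜ[ℤ] la' r p)})

/-- `M ⊗_R N ⊗_R' P`. -/
def BalTensor₃ (ra : M → R → M) (la : R → N → N) (ra' : N → R' → N) (la' : R' → P → P) :
    Type (max v w z) :=
  (M ⊗[ℤ] (N ⊗[ℤ] P)) ⧸ balRel₃ ra la ra' la'

instance (ra : M → R → M) (la : R → N → N) : AddCommGroup (BalTensor ra la) :=
  inferInstanceAs (AddCommGroup ((M ⊗[ℤ] N) ⧸ balRel ra la))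

instance (ra : M → R → M) (la : R → N → N) (ra' : N → R' → N) (la' : R' → P → P) :
    AddCommGroup (BalTensor₃ ra la ra' la') :=
  inferInstanceAs (AddCommGroup ((M ⊗[ℤ] (N ⊗[ℤ] P)) ⧸ balRel₃ ra la ra' la'))

namespace BalTensor

/-- The biadditive map `(m, n) ↦ m ⊗ n` into `M ⊗_R N`. -/
def tmul (ra : M → R → M) (la : R → N → N) : M →+ N →+ BalTensor ra la :=
  AddMonoidHom.mk' (fun m => AddMonoidHom.mk'
    (fun n => (QuotientAddGroup.mk (m ⊗ₜ[ℤ] n) : (M ⊗[ℤ] N) ⧸ balRel ra la))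
    (by intro n n'; rw [TensorProduct.tmul_add]; rfl))
    (by
      intro m m'; ext n
      change (QuotientAddGroup.mk _ : (M ⊗[ℤ] N) ⧸ balRel ra la) = _
      rw [TensorProduct.add_tmul]; rfl)

variable {ra : M → R → M} {la : R → N → N} {ra' : N → R' → N} {la' : R' → P → P}

theorem tmul_rel (m : M) (r : R) (n : N) : tmul ra la (ra m r) n = tmul ra la m (la r n) :=
  (QuotientAddGroup.eq_iff_sub_mem).2 (AddSubgroup.subset_closure ⟨m, r, n, rfl⟩)

/-- The universal property of `M ⊗_R N`. -/
def lift {Q : Type*} [AddCommGroup Q] (f : M →+ N →+ Q)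
    (hf : ∀ m r n, f (ra m r) n = f m (la r n)) : BalTensor ra la →+ Q :=
  QuotientAddGroup.lift (balRel ra la)
    (TensorProduct.liftAddHom f (by intro r m n; simp))
    (by
      refine (AddSubgroup.closure_le _).2 ?_
      rintro _ ⟨m, r, n, rfl⟩
      change _ = _
      simp [hf])

theorem lift_tmul {Q : Type*} [AddCommGroup Q] (f : M →+ N →+ Q)
    (hf : ∀ m r n, f (ra m r) n = f m (la r n)) (m : M) (n : N) :
    lift (ra := ra) (la := la) f hf (tmul ra la m n) = f m n := rfl

/-- Every element is a finite sum of elementary tensors. -/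
theorem exists_rep (y : BalTensor ra la) :
    ∃ (n : ℕ) (a : Fin n → M) (b : Fin n → N), y = ∑ i, tmul ra la (a i) (b i) := by
  obtain ⟨y, rfl⟩ := QuotientAddGroup.mk_surjective y
  induction y using TensorProduct.induction_on with
  | zero => exact ⟨0, Fin.elim0, Fin.elim0, by simp; rfl⟩
  | tmul m n => exact ⟨1, fun _ => m, fun _ => n, by simp; rfl⟩
  | add y z hy hz =>
    obtain ⟨k, a, b, h⟩ := hy
    obtain ⟨l, c, d, h'⟩ := hz
    refine ⟨k + l, Fin.append a c, Fin.append b d, ?_⟩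
    rw [Fin.sum_univ_add]
    simp only [Fin.append_left, Fin.append_right]
    rw [← h, ← h']
    rfl

/-- `(m ⊗ n, p) ↦ m ⊗ n ⊗ p`. -/
def snoc : BalTensor ra la →+ P →+ BalTensor₃ ra la ra' la' :=
  lift
    (AddMonoidHom.mk' (fun m => AddMonoidHom.mk' (fun n => AddMonoidHom.mk'
        (fun p => (QuotientAddGroup.mk (m ⊗ₜ[ℤ] (n ⊗ₜ[ℤ] p)) :
          (M ⊗[ℤ] (N ⊗[ℤ] P)) ⧸ balRel₃ ra la ra' la'))
        (by intro p p'; rw [TensorProduct.tmul_add, TensorProduct.tmul_add]; rfl))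
        (by
          intro n n'; ext p
          change (QuotientAddGroup.mk _ : (M ⊗[ℤ] (N ⊗[ℤ] P)) ⧸ balRel₃ ra la ra' la') = _
          rw [TensorProduct.add_tmul, TensorProduct.tmul_add]; rfl))
      (by
        intro m m'; ext n p
        change (QuotientAddGroup.mk _ : (M ⊗[ℤ] (N ⊗[ℤ] P)) ⧸ balRel₃ ra la ra' la') = _
        rw [TensorProduct.add_tmul]; rfl))
    (by
      intro m r n; ext p
      exact (QuotientAddGroup.eq_iff_sub_mem).2
        (AddSubgroup.subset_closure (Or.inl ⟨m, r, n, p, rfl⟩)))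

/-- `(m, n ⊗ p) ↦ m ⊗ n ⊗ p`. -/
def cons (m : M) : BalTensor ra' la' →+ BalTensor₃ ra la ra' la' :=
  lift
    (AddMonoidHom.mk' (fun n => AddMonoidHom.mk'
        (fun p => (QuotientAddGroup.mk (m ⊗ₜ[ℤ] (n ⊗ₜ[ℤ] p)) :
          (M ⊗[ℤ] (N ⊗[ℤ] P)) ⧸ balRel₃ ra la ra' la'))
        (by intro p p'; rw [TensorProduct.tmul_add, TensorProduct.tmul_add]; rfl))
        (by
          intro n n'; ext p
          change (QuotientAddGroup.mk _ : (M ⊗[ℤ] (N ⊗[ℤ] P)) ⧸ balRel₃ ra la ra' la') = _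
          rw [TensorProduct.add_tmul, TensorProduct.tmul_add]; rfl))
    (by
      intro n r p
      exact (QuotientAddGroup.eq_iff_sub_mem).2
        (AddSubgroup.subset_closure (Or.inr ⟨m, n, r, p, rfl⟩)))

end BalTensor

end BalancedTensor

/-! ### Bialgebroids, comodule algebras, Galois extensions

Conditions written in Sweedler notation are stated for all representations of `Δ(h)` (or of the
coaction) as a finite sum of elementary tensors. -/

/-- A left bialgebroid `H` over `R`. The `R`-bimodule structure of `H` is
`r · h · r' = s(r) t(r') h`. -/
structure LeftBialgebroid (R : Type u) (H : Type v) [Ring R] [Ring H] where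
  s : R →+* H
  t : Rᵐᵒᵖ →+* H
  s_mul_t : ∀ r r', s r * t r' = t r' * s r
  Δ : H →+ BalTensor (fun (h : H) (r : R) => t (op r) * h) (fun (r : R) (h : H) => s r * h)
  ε : H →+ R
  Δ_bimodule : ∀ (h : H) (r r' : R) (n : ℕ) (a b : Fin n → H),
    Δ h = ∑ i, BalTensor.tmul _ _ (a i) (b i) →
    Δ (s r * t (op r') * h) = ∑ i, BalTensor.tmul _ _ (s r * a i) (t (op r') * b i)
  ε_bimodule : ∀ (h : H) (r r' : R), ε (s r * t (op r') * h) = r * ε h * r'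
  coassoc : ∀ (h : H) (n : ℕ) (a b : Fin n → H),
    Δ h = ∑ i, BalTensor.tmul _ _ (a i) (b i) →
    ∑ i, BalTensor.snoc (ra' := fun (h : H) (r : R) => t (op r) * h)
        (la' := fun (r : R) (h : H) => s r * h) (Δ (a i)) (b i)
      = ∑ i, BalTensor.cons (a i) (Δ (b i))
  counit_left : ∀ (h : H) (n : ℕ) (a b : Fin n → H),
    Δ h = ∑ i, BalTensor.tmul _ _ (a i) (b i) → ∑ i, s (ε (a i)) * b i = h
  counit_right : ∀ (h : H) (n : ℕ) (a b : Fin n → H),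
    Δ h = ∑ i, BalTensor.tmul _ _ (a i) (b i) → ∑ i, t (op (ε (b i))) * a i = h
  /-- The image of `Δ` is in the Takeuchi product. -/
  takeuchi : ∀ (h : H) (r : R) (n : ℕ) (a b : Fin n → H),
    Δ h = ∑ i, BalTensor.tmul _ _ (a i) (b i) →
    ∑ i, BalTensor.tmul (fun (h : H) (r : R) => t (op r) * h) (fun (r : R) (h : H) => s r * h)
        (a i * t (op r)) (b i)
      = ∑ i, BalTensor.tmul _ _ (a i) (b i * s r)
  Δ_one : Δ 1 = BalTensor.tmul _ _ 1 1
  Δ_mul : ∀ (h h' : H) (n n' : ℕ) (a b : Fin n → H) (a' b' : Fin n' → H),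
    Δ h = ∑ i, BalTensor.tmul _ _ (a i) (b i) → Δ h' = ∑ j, BalTensor.tmul _ _ (a' j) (b' j) →
    Δ (h * h') = ∑ i, ∑ j, BalTensor.tmul _ _ (a i * a' j) (b i * b' j)
  ε_one : ε 1 = 1
  ε_mul_s : ∀ h h' : H, ε (h * s (ε h')) = ε (h * h')
  ε_mul_t : ∀ h h' : H, ε (h * t (op (ε h'))) = ε (h * h')

/-- A right comodule algebra `A` over a left bialgebroid `H` over `R`: an `R`-ring `π : R → A` with
a coaction `δ : A → A ⊗_R H`, `δ(a) = a₀ ⊗ a₁`, where `R` acts on `A` by right multiplication and on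
`H` by left multiplication with `s(r)`. -/
structure RightComoduleAlgebra {R : Type u} {H : Type v} [Ring R] [Ring H]
    (K : LeftBialgebroid R H) (A : Type w) [Ring A] where
  π : R →+* A
  δ : A →+ BalTensor (fun (a : A) (r : R) => a * π r) (fun (r : R) (h : H) => K.s r * h)
  δ_bimodule : ∀ (a : A) (r r' : R) (n : ℕ) (x : Fin n → A) (y : Fin n → H),
    δ a = ∑ i, BalTensor.tmul _ _ (x i) (y i) →
    δ (π r' * a * π r) = ∑ i, BalTensor.tmul _ _ (x i) (K.t (op r) * y i * K.t (op r'))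
  coassoc : ∀ (a : A) (n : ℕ) (x : Fin n → A) (y : Fin n → H),
    δ a = ∑ i, BalTensor.tmul _ _ (x i) (y i) →
    ∑ i, BalTensor.snoc (ra' := fun (h : H) (r : R) => K.t (op r) * h)
        (la' := fun (r : R) (h : H) => K.s r * h) (δ (x i)) (y i)
      = ∑ i, BalTensor.cons (x i) (K.Δ (y i))
  counit : ∀ (a : A) (n : ℕ) (x : Fin n → A) (y : Fin n → H),
    δ a = ∑ i, BalTensor.tmul _ _ (x i) (y i) → ∑ i, x i * π (K.ε (y i)) = a
  /-- The image of `δ` is in the Takeuchi product. -/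
  takeuchi : ∀ (a : A) (r : R) (n : ℕ) (x : Fin n → A) (y : Fin n → H),
    δ a = ∑ i, BalTensor.tmul _ _ (x i) (y i) →
    ∑ i, BalTensor.tmul (fun (a : A) (r : R) => a * π r) (fun (r : R) (h : H) => K.s r * h)
        (π r * x i) (y i)
      = ∑ i, BalTensor.tmul _ _ (x i) (y i * K.s r)
  δ_one : δ 1 = BalTensor.tmul _ _ 1 1
  /-- `(a a')₀ ⊗ (a a')₁ = a₀ a'₀ ⊗ a'₁ a₁`. -/
  δ_mul : ∀ (a a' : A) (n n' : ℕ) (x : Fin n → A) (y : Fin n → H) (x' : Fin n' → A)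
    (y' : Fin n' → H),
    δ a = ∑ i, BalTensor.tmul _ _ (x i) (y i) → δ a' = ∑ j, BalTensor.tmul _ _ (x' j) (y' j) →
    δ (a * a') = ∑ i, ∑ j, BalTensor.tmul _ _ (x i * x' j) (y' j * y i)

namespace RightComoduleAlgebra

variable {R : Type u} {H : Type v} [Ring R] [Ring H] {K : LeftBialgebroid R H} {A : Type w} [Ring A]

/-- Left multiplication of `A` on the first factor of `A ⊗_R H`. -/
def lmul (M : RightComoduleAlgebra K A) (a : A) :
    BalTensor (fun (a : A) (r : R) => a * M.π r) (fun (r : R) (h : H) => K.s r * h) →+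
      BalTensor (fun (a : A) (r : R) => a * M.π r) (fun (r : R) (h : H) => K.s r * h) :=
  BalTensor.lift ((BalTensor.tmul _ _).comp (AddMonoidHom.mulLeft a)) (by
    intro x r h
    change BalTensor.tmul _ _ (a * (x * M.π r)) h = BalTensor.tmul _ _ (a * x) (K.s r * h)
    rw [← mul_assoc]
    exact BalTensor.tmul_rel (a * x) r h)

/-- The ring homomorphism `ρ : B → A` is a right `H`-Galois extension: `ρ(B)` is the algebra of
coinvariants `{a | δ(a) = a ⊗ 1}`, and the Galois map `Γ : A ⊗_B A → A ⊗_R H`,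
`a ⊗ a' ↦ a a'₀ ⊗ a'₁`, is well-defined and bijective. -/
def IsGalois (M : RightComoduleAlgebra K A) {B : Type z} [Ring B] (ρ : B →+* A) : Prop :=
  (∀ a : A, M.δ a = BalTensor.tmul _ _ a 1 ↔ a ∈ ρ.range) ∧
  ∃ Γ : BalTensor (fun (a : A) (b : B) => a * ρ b) (fun (b : B) (a : A) => ρ b * a) →+
      BalTensor (fun (a : A) (r : R) => a * M.π r) (fun (r : R) (h : H) => K.s r * h),
    (∀ a a' : A, Γ (BalTensor.tmul _ _ a a') = M.lmul a (M.δ a')) ∧ Function.Bijective Γ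

end RightComoduleAlgebra

/-- `f : N → M` is a split `N`-ring: there is an `N`-bimodule map `E : M → N` with `E(1) = 1`. -/
def IsSplit {N : Type u} {M : Type v} [Ring N] [Ring M] (f : N →+* M) : Prop :=
  ∃ E : M →+ N, (∀ (n n' : N) (x : M), E (f n * x * f n') = n * E x * n') ∧ E 1 = 1

/-! ### The bialgebroid `End(σσ^l)` and its coaction -/

section EndBialgebroid

variable {B : Type u} [Ring B] {l σ : B →+* B} (adj : Adj l σ)

theorem Adj.e_rel (b : B) : adj.e * l (σ b) = b * adj.e := adj.e_mem b

theorem Adj.m_rel (b : B) : adj.m * b = σ (l b) * adj.m := adj.m_mem b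

theorem Adj.e_rel_assoc (b c : B) : adj.e * (l (σ b) * c) = b * (adj.e * c) := by
  rw [← mul_assoc, adj.e_rel, mul_assoc]

/-- For `x : σ → σα`, the element `e l(x m)` is a 2-cell `l → αl`. -/
theorem Adj.transpose_rel {α : B →+* B} {x : B} (hx : x ∈ Hom σ (σ.comp α)) (b : B) :
    adj.e * l (x * adj.m) * l b = α (l b) * (adj.e * l (x * adj.m)) := by
  have hx' : x * σ (l b) = σ (α (l b)) * x := hx (l b)
  rw [mul_assoc, ← map_mul, mul_assoc x, adj.m_rel, ← mul_assoc x, hx', mul_assoc, map_mul,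
    adj.e_rel_assoc]

/-- For `f : σα → σ` and `x : σ → σα`, the element `f σ(e l(x m))` of `End(σl)`. -/
def Adj.coeff {α : B →+* B} (f : Hom (σ.comp α) σ) (x : Hom σ (σ.comp α)) : End (σ.comp l) :=
  ⟨f * σ (adj.e * l (x * adj.m)), by
    intro b
    have hf : (f : B) * σ (α (l b)) = σ (l b) * f := f.2 (l b)
    change (f : B) * σ _ * σ (l b) = σ (l b) * (f * σ _)
    rw [mul_assoc, ← map_mul, adj.transpose_rel x.2, map_mul, ← mul_assoc, hf, mul_assoc]⟩

/-- For `h : σl → σl` and `q : σ → σlσ`, the element `σ(e) h σ(e l(q m))` of `End(σl)`. -/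
def Adj.leg₁ (h : End (σ.comp l)) (q : Hom σ ((σ.comp l).comp σ)) : End (σ.comp l) :=
  ⟨σ adj.e * h * σ (adj.e * l (q * adj.m)), by
    intro b
    have hq : adj.e * l (q * adj.m) * l b = l (σ (l b)) * (adj.e * l (q * adj.m)) :=
      adj.transpose_rel (α := l.comp σ) q.2 b
    have hh : (h : B) * σ (l (σ (l b))) = σ (l (σ (l b))) * h := h.2 (σ (l b))
    change σ adj.e * h * σ _ * σ (l b) = σ (l b) * (σ adj.e * h * σ _)
    rw [mul_assoc, ← map_mul, hq, map_mul, ← mul_assoc, mul_assoc (σ adj.e), hh, ← mul_assoc,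
      ← map_mul, adj.e_rel, map_mul]
    simp only [mul_assoc]⟩

/-- For `p : σlσ → σ`, the element `p σl(m)` of `End(σl)`. -/
def Adj.leg₂ (p : Hom ((σ.comp l).comp σ) σ) : End (σ.comp l) :=
  ⟨p * σ (l adj.m), by
    intro b
    have hp : (p : B) * σ (l (σ (l b))) = σ (l b) * p := p.2 (l b)
    change (p : B) * σ (l adj.m) * σ (l b) = σ (l b) * (p * σ (l adj.m))
    rw [mul_assoc, ← map_mul, ← map_mul, adj.m_rel, map_mul, map_mul, ← mul_assoc, hp,
      mul_assoc]⟩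

/-- The left bialgebroid structure of `End(σl)` over `End(σ)` attached to an adjunction `l ⊣ σ`:
source `r ↦ r`, target `r ↦ σ(r^l)`, comultiplication
`h ↦ ∑ σ(e) h σ(e l(q_i m)) ⊗ p_i σl(m)` for any direct summand diagram
`σlσ → σ → σlσ` with components `p_i`, `q_i`, and counit `h ↦ σ(e) h m`. -/
structure IsEndBialgebroid (K : LeftBialgebroid (End σ) (End (σ.comp l))) : Prop where
  source : ∀ r : End σ, (K.s r : B) = r
  target : ∀ r : End σ, (K.t (op r) : B) = σ (adj.dual r)
  comul : ∀ {ι : Type} [Fintype ι] (p q : ι → B)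
    (hpq : IsSummandDiagram ((σ.comp l).comp σ) σ p q) (h : End (σ.comp l)),
    K.Δ h = ∑ i, BalTensor.tmul _ _ (adj.leg₁ h ⟨q i, hpq.right i⟩) (adj.leg₂ ⟨p i, hpq.left i⟩)
  counit : ∀ h : End (σ.comp l), (K.ε h : B) = σ adj.e * h * adj.m

/-- The coaction of `End(σl)` on the field algebra of `F = Hom(σ, σ _)`:
`b ⊗_α x ↦ ∑ (b ⊗_α x_i) ⊗ f_i σ(e l(x m))` for any direct summand diagram `σα → σ → σα` with
components `f_i`, `x_i`; the underlying `End(σ)`-ring structure is `r ↦ 1 ⊗_ι r`. -/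
structure IsFieldCoaction (C : Submonoid (B →+* B))
    {K : LeftBialgebroid (End σ) (End (σ.comp l))}
    (M : RightComoduleAlgebra K (FieldAlgebra (homFunctor σ C))) : Prop where
  base : M.π = baseMap σ C
  coaction : ∀ (α : C) (b : B) (x : Hom σ (σ.comp (α : B →+* B))) {ι : Type} [Fintype ι]
    (f y : ι → B) (hfy : IsSummandDiagram (σ.comp (α : B →+* B)) σ f y),
    M.δ (FieldAlgebra.word (homFunctor σ C) α b (toObj α x))
      = ∑ i, BalTensor.tmul _ _
          (FieldAlgebra.word (homFunctor σ C) α b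
            (toObj α ⟨y i, hfy.right i⟩))
          (adj.coeff ⟨f i, hfy.left i⟩ x)

end EndBialgebroid

end FieldAlg

/-! Write `l` for the left dual of `σ`, `S = End(σ)` and `H = End(σl)`. Every object in the theorem
can be identified with, or embedded in, a group of elements of `B`. There the axioms become short
computations with the two triangle identities and the intertwining relations.

The functor `Hom(σ, σ _)` is represented by `lσ`, with universal element `m`: any `x : σ → σα`
equals `σ(e l(x)) m`. By a Yoneda argument the field algebra `A` is therefore `B` itself, via `b ⊗_α
x ↦ σ(b) x` with inverse `z ↦ e l(z) ⊗_{lσ} m` (`evalEquiv`). Under this identification `ρ_F`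
becomes `σ`, and `S → A` becomes the inclusion.

A summand diagram `σlσ → σ → σlσ` gives `H` a finite dual basis as a left `S`-module: the elements
are `p_i σl(m)` and the coordinates `h ↦ σ(e) h q_i` (`sum_coord_mul_leg₂`). It yields `H ⊗_S H ≅
Hom(σlσl, σl)` through `h ⊗ h' ↦ σ(e l(h')) h` and `A ⊗_S H ≅ B` through `a ⊗ h ↦ Ψ(a) σ(e) h`,
together with embeddings of the corresponding triple tensor products. In these models `Δ(h)` is `h
σ(e)` and `δ(a)` is `σ(e l(Ψ(a)))`. Neither mentions the summand diagram, so the formulas for `Δ`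
and `δ` do not depend on the diagram chosen.

For the Galois map, `a ⊗ a' ↦ Ψ(a) σ(e l(Ψ(a')))` is a bijection `A ⊗_B A → B`, with inverse `z ↦ z
⊗ m` up to `Ψ`. Composing it with the inverse of `A ⊗_S H ≅ B` gives the Galois map.

The condition `id ≤ σ` supplies `b_i : id → σ` and `a_i : σ → id` with `∑ a_i b_i = 1`. Conjugating
with these splits `ρ_F`. Their mates `e l(b_i)` and `a_i m` exhibit `id ≤ l`, which splits `S → H`
and forces the coinvariants into `σ(B)`. -/

namespace FieldAlg

/-! ### Balanced tensor products -/

namespace BalTensor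

variable {R : Type u} {R' : Type u} {M : Type v} {N : Type w} {P : Type z}
  [AddCommGroup M] [AddCommGroup N] [AddCommGroup P]
  {ra : M → R → M} {la : R → N → N} {ra' : N → R' → N} {la' : R' → P → P}

variable (ra la) in
/-- The projection `M ⊗ N → M ⊗_R N`. -/
def mkHom : M ⊗[ℤ] N →+ BalTensor ra la := QuotientAddGroup.mk' (balRel ra la)

theorem induction {p : BalTensor ra la → Prop} (h0 : p 0)
    (ht : ∀ m n, p (tmul ra la m n)) (ha : ∀ y z, p y → p z → p (y + z)) (y : BalTensor ra la) :
    p y := by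
  obtain ⟨y, rfl⟩ := QuotientAddGroup.mk_surjective y
  induction y using TensorProduct.induction_on with
  | zero => exact h0
  | tmul m n => exact ht m n
  | add y z hy hz => exact ha _ _ hy hz

theorem hom_ext {Q : Type*} [AddCommGroup Q] {f g : BalTensor ra la →+ Q}
    (h : ∀ m n, f (tmul ra la m n) = g (tmul ra la m n)) : f = g := by
  ext y
  induction y using BalTensor.induction with
  | h0 => simp
  | ht m n => exact h m n
  | ha y z hy hz => rw [map_add, map_add, hy, hz]

/-- Elementary tensors generate, so a left inverse need only be checked on them. All comparisons
with intertwiner groups use this criterion. -/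
theorem injective_of_section {Q : Type*} [AddCommGroup Q] {f : BalTensor ra la →+ Q}
    (g : Q →+ BalTensor ra la) (h : ∀ m n, g (f (tmul ra la m n)) = tmul ra la m n) :
    Function.Injective f :=
  Function.LeftInverse.injective (g := g) fun y =>
    DFunLike.congr_fun (hom_ext (f := g.comp f) (g := AddMonoidHom.id _) h) y

end BalTensor

/-! ### Threefold balanced tensor products -/

namespace BalTensor₃

variable {R : Type u} {R' : Type u} {M : Type v} {N : Type w} {P : Type z}
  [AddCommGroup M] [AddCommGroup N] [AddCommGroup P]
  {ra : M → R → M} {la : R → N → N} {ra' : N → R' → N} {la' : R' → P → P}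

/-- The elementary tensor `m ⊗ n ⊗ p`. -/
def tmul (ra : M → R → M) (la : R → N → N) (ra' : N → R' → N) (la' : R' → P → P)
    (m : M) (n : N) (p : P) : BalTensor₃ ra la ra' la' :=
  BalTensor.snoc (BalTensor.tmul ra la m n) p

theorem induction {p : BalTensor₃ ra la ra' la' → Prop} (h0 : p 0)
    (ht : ∀ m n k, p (tmul ra la ra' la' m n k)) (ha : ∀ y z, p y → p z → p (y + z))
    (y : BalTensor₃ ra la ra' la') : p y := by
  obtain ⟨y, rfl⟩ := QuotientAddGroup.mk_surjective y
  induction y using TensorProduct.induction_on with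
  | zero => exact h0
  | add y z hy hz => exact ha _ _ hy hz
  | tmul m y =>
    induction y using TensorProduct.induction_on with
    | zero => rw [TensorProduct.tmul_zero]; exact h0
    | add y z hy hz => rw [TensorProduct.tmul_add]; exact ha _ _ hy hz
    | tmul n k => exact ht m n k

/-- The universal property of `M ⊗_R N ⊗_R' P`. -/
def lift {Q : Type*} [AddCommGroup Q] (f : M →+ BalTensor ra' la' →+ Q)
    (hf : ∀ m r n p, f (ra m r) (BalTensor.tmul ra' la' n p)
      = f m (BalTensor.tmul ra' la' (la r n) p)) : BalTensor₃ ra la ra' la' →+ Q :=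
  QuotientAddGroup.lift (balRel₃ ra la ra' la')
    (TensorProduct.liftAddHom
      ((AddMonoidHom.compHom' (BalTensor.mkHom ra' la')).comp f)
      (by intro r m n; rw [map_zsmul, map_zsmul, AddMonoidHom.zsmul_apply]))
    (by
      refine (AddSubgroup.closure_le _).2 ?_
      rintro _ (⟨m, r, n, p, rfl⟩ | ⟨m, n, r, p, rfl⟩)
      · refine (map_sub _ _ _).trans ?_
        exact sub_eq_zero.2 (hf m r n p)
      · refine (map_sub _ _ _).trans ?_
        exact sub_eq_zero.2 (congrArg (f m) (BalTensor.tmul_rel n r p)))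

theorem lift_cons {Q : Type*} [AddCommGroup Q] (f : M →+ BalTensor ra' la' →+ Q)
    (hf : ∀ m r n p, f (ra m r) (BalTensor.tmul ra' la' n p)
      = f m (BalTensor.tmul ra' la' (la r n) p)) (m : M) (y : BalTensor ra' la') :
    lift (ra := ra) (la := la) f hf (BalTensor.cons m y) = f m y := by
  refine DFunLike.congr_fun (BalTensor.hom_ext
    (f := (lift (ra := ra) (la := la) f hf).comp (BalTensor.cons m)) (g := f m) ?_) y
  intro n p
  rfl

theorem injective_of_section {Q : Type*} [AddCommGroup Q] {f : BalTensor₃ ra la ra' la' →+ Q}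
    (g : Q →+ BalTensor₃ ra la ra' la')
    (h : ∀ m n p, g (f (tmul ra la ra' la' m n p)) = tmul ra la ra' la' m n p) :
    Function.Injective f := by
  refine Function.LeftInverse.injective (g := g) fun y => ?_
  induction y using BalTensor₃.induction with
  | h0 => simp
  | ht m n p => exact h m n p
  | ha y z hy hz => rw [map_add, map_add, hy, hz]

end BalTensor₃

/-! ### Identities for an adjunction between endomorphisms -/

section Identities

variable {B : Type u} [Ring B] {l σ : B →+* B} (adj : Adj l σ)

namespace Adj

theorem map_e_mul_m : σ adj.e * adj.m = 1 := adj.right_triangle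

theorem map_e_mul_m_assoc (b : B) : σ adj.e * (adj.m * b) = b := by
  rw [← mul_assoc, adj.map_e_mul_m, one_mul]

theorem e_mul_map_m : adj.e * l adj.m = 1 := adj.left_triangle

/-- `y ↦ e l(y)` is a section of `z ↦ σ(z) m`. -/
theorem map_e_mul_map_mul_m (y : B) : σ (adj.e * l y) * adj.m = y := by
  rw [map_mul, mul_assoc, ← adj.m_rel, adj.map_e_mul_m_assoc]

theorem e_mul_e (b : B) : adj.e * (adj.e * l b) = adj.e * l (σ adj.e * b) := by
  rw [map_mul, adj.e_rel_assoc]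

theorem dual_eq (r : B) : adj.dual r = adj.e * l (r * adj.m) := by
  rw [Adj.dual, map_mul, mul_assoc]

theorem end_comm (r : End σ) (b : B) : (r : B) * σ b = σ b * r := r.2 b

theorem end_comm_assoc (r : End σ) (b c : B) : (r : B) * (σ b * c) = σ b * (r * c) := by
  rw [← mul_assoc, end_comm, mul_assoc]

theorem endComp_comm (h : End (σ.comp l)) (b : B) : (h : B) * σ (l b) = σ (l b) * h := h.2 b

theorem endComp_comm_assoc (h : End (σ.comp l)) (b c : B) :
    (h : B) * (σ (l b) * c) = σ (l b) * (h * c) := by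
  rw [← mul_assoc, endComp_comm, mul_assoc]

theorem dual_comm (r : End σ) (b : B) : adj.dual r * l b = l b * adj.dual r := by
  rw [adj.dual_eq]
  exact adj.transpose_rel (α := RingHom.id B) (x := r) r.2 b

/-- The mate property of `r^l` at the counit. It lets target elements cross the tensor sign and lies
behind the Takeuchi condition. -/
theorem e_mul_dual (r : End σ) : adj.e * adj.dual r = adj.e * l r := by
  rw [adj.dual_eq, adj.e_mul_e, ← end_comm_assoc, adj.map_e_mul_m, mul_one]

theorem map_dual_mul_m (r : B) : σ (adj.dual r) * adj.m = r * adj.m := by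
  rw [adj.dual_eq, adj.map_e_mul_map_mul_m]

/-- Since `r^l` commutes with `l(B)`, it slides left past `l(r')` and `l(m)` until it meets `e`,
where it turns into `l(r)`. This reverses the order. -/
theorem dual_mul (r r' : End σ) : adj.dual (r * r' : B) = adj.dual r' * adj.dual r := by
  have h : adj.dual (r' : B) * adj.dual r = adj.e * (adj.dual r * (l r' * l adj.m)) := by
    have hr : adj.dual (r' : B) = adj.e * (l r' * l adj.m) := mul_assoc _ _ _
    rw [hr, mul_assoc, mul_assoc, ← adj.dual_comm, ← mul_assoc (l _), ← adj.dual_comm, mul_assoc]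
  rw [h, ← mul_assoc, e_mul_dual, Adj.dual, map_mul]
  simp only [mul_assoc]

theorem dual_one : adj.dual 1 = 1 := by
  rw [Adj.dual, map_one, mul_one, adj.e_mul_map_m]

theorem dual_add (r r' : B) : adj.dual (r + r') = adj.dual r + adj.dual r' := by
  simp [Adj.dual, mul_add, add_mul]

theorem dual_zero : adj.dual 0 = 0 := by simp [Adj.dual]

end Adj

/-- The source map `End(σ) → End(σl)`, the inclusion. -/
def sourceHom (σ l : B →+* B) : End σ →+* End (σ.comp l) :=
  Subring.inclusion fun _ hx b => hx (l b)

theorem coe_sourceHom (r : End σ) : (sourceHom σ l r : B) = r := rfl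

/-- The target map `End(σ)ᵒᵖ → End(σl)`, `r ↦ σ(r^l)`. -/
def Adj.targetHom : (End σ)ᵐᵒᵖ →+* End (σ.comp l) where
  toFun r := ⟨σ (adj.dual (unop r : End σ)), fun b => by
    change σ _ * σ (l b) = σ (l b) * σ _
    rw [← map_mul, adj.dual_comm, map_mul]⟩
  map_one' := Subtype.ext (by simp [adj.dual_one])
  map_zero' := Subtype.ext (by simp [adj.dual_zero])
  map_add' r r' := Subtype.ext (by simp [adj.dual_add])
  map_mul' r r' := Subtype.ext (by simp [adj.dual_mul])

theorem Adj.coe_targetHom (r : End σ) : (adj.targetHom (op r) : B) = σ (adj.dual r) := rfl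

/-- `e h q ∈ End(σ)` for `h : σl → σl` and `q : σ → σlσ`. -/
def Adj.coord (h : End (σ.comp l)) (q : Hom σ ((σ.comp l).comp σ)) : End σ :=
  ⟨σ adj.e * h * q, fun b => by
    have hq : (q : B) * σ b = σ (l (σ b)) * q := q.2 b
    rw [mul_assoc, hq, mul_assoc, Adj.endComp_comm_assoc, ← mul_assoc, ← map_mul, adj.e_rel,
      map_mul]
    simp only [mul_assoc]⟩

/-- A dual basis of `H` over `S`: once `∑ q_i p_i = 1` is used, `σ(e) h σl(m)` remains, and it
equals `h` because `h` commutes with `σl(m)` and `e l(m) = 1`. -/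
theorem Adj.sum_coord_mul_leg₂ {ι : Type} [Fintype ι] {p q : ι → B}
    (hpq : IsSummandDiagram ((σ.comp l).comp σ) σ p q) (h : End (σ.comp l)) :
    ∑ i, sourceHom σ l (adj.coord h ⟨q i, hpq.right i⟩) * adj.leg₂ ⟨p i, hpq.left i⟩ = h := by
  ext
  have h1 : ∀ i, ((sourceHom σ l (adj.coord h ⟨q i, hpq.right i⟩)
      * adj.leg₂ ⟨p i, hpq.left i⟩ : End (σ.comp l)) : B)
      = σ adj.e * h * (q i * p i) * σ (l adj.m) := by
    intro i
    change σ adj.e * h * q i * (p i * σ (l adj.m)) = _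
    simp only [mul_assoc]
  rw [AddSubmonoidClass.coe_finsetSum]
  simp only [h1]
  rw [← Finset.sum_mul, ← Finset.mul_sum, hpq.sum_eq, mul_one, mul_assoc, Adj.endComp_comm,
    ← mul_assoc, ← map_mul, adj.e_mul_map_m, map_one, one_mul]

end Identities

/-! ### The bialgebroid `End(σl)` -/

section Bialgebroid

variable {B : Type u} [Ring B] {l σ : B →+* B} (adj : Adj l σ)

/-! ### Tensor powers of `H` as intertwiners -/

namespace Adj

/-- The tensor product `H ⊗_S H` for `H = End(σl)` and `S = End(σ)`. -/
abbrev TensorSq : Type u :=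
  BalTensor (fun (h : End (σ.comp l)) (r : End σ) => adj.targetHom (op r) * h)
    (fun (r : End σ) (h : End (σ.comp l)) => sourceHom σ l r * h)

/-- The tensor product `H ⊗_S H ⊗_S H` for `H = End(σl)` and `S = End(σ)`. -/
abbrev TensorCube : Type u :=
  BalTensor₃ (fun (h : End (σ.comp l)) (r : End σ) => adj.targetHom (op r) * h)
    (fun (r : End σ) (h : End (σ.comp l)) => sourceHom σ l r * h)
    (fun (h : End (σ.comp l)) (r : End σ) => adj.targetHom (op r) * h)
    (fun (r : End σ) (h : End (σ.comp l)) => sourceHom σ l r * h)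

/-- The elementary tensor `h ⊗ h'` in `H ⊗_S H`. -/
abbrev tmulSq : End (σ.comp l) →+ End (σ.comp l) →+ adj.TensorSq := BalTensor.tmul _ _

/-- The 2-cell `σ(e l(g)) h : σlγ → σl` for `g : γ → σl` and `h : σl → σl`. -/
theorem pairing_mem {γ : B →+* B} {g : B} (hg : g ∈ Hom γ (σ.comp l)) (h : End (σ.comp l)) :
    σ (adj.e * l g) * h ∈ Hom ((σ.comp l).comp γ) (σ.comp l) := by
  intro b
  have hg' : g * γ b = σ (l b) * g := hg b
  change σ (adj.e * l g) * h * σ (l (γ b)) = σ (l b) * (σ (adj.e * l g) * h)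
  rw [mul_assoc, endComp_comm, ← mul_assoc, ← map_mul, mul_assoc, ← map_mul, hg', map_mul l,
    adj.e_rel_assoc, map_mul, mul_assoc]

/-- The biadditive map `(h, g) ↦ σ(e l(g)) h`. -/
def pairingHom (γ : B →+* B) :
    End (σ.comp l) →+ Hom γ (σ.comp l) →+ Hom ((σ.comp l).comp γ) (σ.comp l) :=
  AddMonoidHom.mk' (fun h => AddMonoidHom.mk'
      (fun g => ⟨σ (adj.e * l g) * h, adj.pairing_mem g.2 h⟩)
      (by intro g g'; ext; simp [mul_add, add_mul]))
    (by intro h h'; ext g; simp [mul_add])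

theorem pairingHom_target {γ : B →+* B} (r : End σ) (h : End (σ.comp l)) (g : Hom γ (σ.comp l)) :
    (adj.pairingHom γ (adj.targetHom (op r) * h) g : B) = σ (adj.e * l (r * g)) * h := by
  change σ (adj.e * l g) * (σ (adj.dual r) * h) = _
  rw [← mul_assoc, ← map_mul, mul_assoc, ← adj.dual_comm, ← mul_assoc, adj.e_mul_dual, mul_assoc,
    ← map_mul]

/-- Elements of `End(σl)` as intertwiners. -/
def endHom (σ l : B →+* B) : End (σ.comp l) →+ Hom (σ.comp l) (σ.comp l) :=
  AddMonoidHom.mk' (fun h => ⟨h, h.2⟩) (fun _ _ => rfl)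

/-- The map `H ⊗_S H → Hom(σlσl, σl)`, `h ⊗ h' ↦ σ(e l(h')) h`. -/
def pairing : adj.TensorSq →+ Hom ((σ.comp l).comp (σ.comp l)) (σ.comp l) :=
  BalTensor.lift
    ((AddMonoidHom.compHom' (endHom σ l)).comp (adj.pairingHom (σ.comp l)))
    (by
      intro h r h'
      exact Subtype.ext (adj.pairingHom_target r h (endHom σ l h')))

theorem coe_pairing_tmul (h h' : End (σ.comp l)) :
    (adj.pairing (adj.tmulSq h h') : B) = σ (adj.e * l h') * h := rfl

theorem coe_pairing_sum {ι : Type} [Fintype ι] (a b : ι → End (σ.comp l)) :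
    (adj.pairing (∑ i, adj.tmulSq (a i) (b i)) : B) = ∑ i, σ (adj.e * l (b i)) * a i := by
  rw [map_sum, AddSubmonoidClass.coe_finsetSum]
  rfl

/-- The 2-cell `σ(e) g d : γ → σl` for `g : δ → σl` and `d : γ → δσl`, as an additive map in `g`. -/
def contract {γ δ : B →+* B} (d : Hom γ (δ.comp (σ.comp l))) :
    Hom δ (σ.comp l) →+ Hom γ (σ.comp l) :=
  AddMonoidHom.mk' (fun g => ⟨σ adj.e * g * d, by
      intro b
      have hd : (d : B) * γ b = δ (σ (l b)) * d := d.2 b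
      have hg : (g : B) * δ (σ (l b)) = σ (l (σ (l b))) * g := g.2 (σ (l b))
      change σ adj.e * g * d * γ b = σ (l b) * (σ adj.e * g * d)
      rw [mul_assoc, hd, mul_assoc, ← mul_assoc (g : B), hg, mul_assoc, ← mul_assoc, ← map_mul,
        adj.e_rel, map_mul]
      simp only [mul_assoc]⟩)
    (by intro g g'; ext; simp [mul_add, add_mul])

/-- The 2-cell `γ(q m) : γ → γσlσl` for `q : σ → σlσ`. -/
def insert (γ : B →+* B) (q : Hom σ ((σ.comp l).comp σ)) :
    Hom γ ((γ.comp (σ.comp l)).comp (σ.comp l)) :=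
  ⟨γ (q * adj.m), by
    intro b
    have hq : (q : B) * σ (l b) = σ (l (σ (l b))) * q := q.2 (l b)
    change γ (q * adj.m) * γ b = γ (σ (l (σ (l b)))) * γ (q * adj.m)
    rw [← map_mul, mul_assoc, adj.m_rel, ← mul_assoc, hq, ← map_mul, mul_assoc]⟩

/-- An intertwiner `σl → σl` as an element of the ring `End(σl)`. -/
def homEnd (σ l : B →+* B) : Hom (σ.comp l) (σ.comp l) →+ End (σ.comp l) :=
  AddMonoidHom.mk' (fun h => ⟨h, h.2⟩) (fun _ _ => rfl)

theorem dual_coord (h : End (σ.comp l)) (q : Hom σ ((σ.comp l).comp σ)) :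
    adj.dual (adj.coord h q) = adj.e * (adj.e * l (h * (q * adj.m))) := by
  rw [adj.dual_eq, adj.e_mul_e]
  simp only [coord, mul_assoc]

/-- Contracting `σ(e l(g)) h` is acting on `h` with the coordinates of `g`. -/
theorem contract_pairing (h h' : End (σ.comp l)) (q : Hom σ ((σ.comp l).comp σ)) :
    homEnd σ l (adj.contract (adj.insert (σ.comp l) q) (adj.pairing (adj.tmulSq h h')))
      = adj.targetHom (op (adj.coord h' q)) * h := by
  ext
  change σ adj.e * (σ (adj.e * l h') * h) * σ (l (q * adj.m)) = σ (adj.dual (adj.coord h' q)) * h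
  rw [dual_coord, mul_assoc, mul_assoc, endComp_comm, ← mul_assoc, ← mul_assoc, ← map_mul,
    ← map_mul, mul_assoc, mul_assoc, ← map_mul]

section Summand

variable {ι : Type} [Fintype ι] {p q : ι → B} (hpq : IsSummandDiagram ((σ.comp l).comp σ) σ p q)

/-- The inverse `g ↦ ∑ σ(e) g σ(l(q_i m)) ⊗ p_i σl(m)` of the pairing. -/
def copairing : Hom ((σ.comp l).comp (σ.comp l)) (σ.comp l) →+ adj.TensorSq :=
  ∑ i, (adj.tmulSq.flip (adj.leg₂ ⟨p i, hpq.left i⟩)).comp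
    ((homEnd σ l).comp (adj.contract (adj.insert (σ.comp l) ⟨q i, hpq.right i⟩)))

theorem copairing_apply (g : Hom ((σ.comp l).comp (σ.comp l)) (σ.comp l)) :
    adj.copairing hpq g = ∑ i, adj.tmulSq
      (homEnd σ l (adj.contract (adj.insert (σ.comp l) ⟨q i, hpq.right i⟩) g))
      (adj.leg₂ ⟨p i, hpq.left i⟩) := by
  rw [copairing, AddMonoidHom.finsetSum_apply]
  rfl

/-- Expand `h'` in the dual basis and move its coordinates across the tensor sign, where they act
through the target map. -/
theorem sum_target_tmulSq (h h' : End (σ.comp l)) :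
    ∑ i, adj.tmulSq (adj.targetHom (op (adj.coord h' ⟨q i, hpq.right i⟩)) * h)
      (adj.leg₂ ⟨p i, hpq.left i⟩) = adj.tmulSq h h' := by
  conv_rhs => rw [← adj.sum_coord_mul_leg₂ hpq h', map_sum]
  exact Finset.sum_congr rfl fun i _ => BalTensor.tmul_rel _ _ _

theorem copairing_pairing (h h' : End (σ.comp l)) :
    adj.copairing hpq (adj.pairing (adj.tmulSq h h')) = adj.tmulSq h h' := by
  rw [copairing_apply]
  refine Eq.trans ?_ (adj.sum_target_tmulSq hpq h h')
  refine Finset.sum_congr rfl fun i _ => ?_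
  rw [contract_pairing]

end Summand

theorem pairing_injective {ι : Type} [Fintype ι] {p q : ι → B}
    (hpq : IsSummandDiagram ((σ.comp l).comp σ) σ p q) : Function.Injective adj.pairing :=
  BalTensor.injective_of_section (adj.copairing hpq) (adj.copairing_pairing hpq)

/-- The map `H ⊗_S H ⊗_S H → Hom(σlσlσl, σl)`, `h ⊗ h' ⊗ h'' ↦ σ(e l(σ(e l(h'')) h')) h`. -/
def pairing₃ : adj.TensorCube →+
    Hom ((σ.comp l).comp ((σ.comp l).comp (σ.comp l))) (σ.comp l) :=
  BalTensor₃.lift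
    ((AddMonoidHom.compHom' adj.pairing).comp (adj.pairingHom ((σ.comp l).comp (σ.comp l))))
    (by
      intro h r h' h''
      refine Subtype.ext ((adj.pairingHom_target r h (adj.pairing (adj.tmulSq h' h''))).trans ?_)
      change σ (adj.e * l (r * (σ (adj.e * l h'') * h'))) * h
        = σ (adj.e * l (σ (adj.e * l h'') * (r * h'))) * h
      rw [end_comm_assoc])

theorem coe_pairing₃_cons (h : End (σ.comp l)) (y : adj.TensorSq) :
    (adj.pairing₃ (BalTensor.cons h y) : B) = σ (adj.e * l (adj.pairing y)) * h :=
  congrArg Subtype.val (BalTensor₃.lift_cons _ _ h y)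

/-- The triple pairing can be computed by bracketing on either side, which is what makes the two
sides of coassociativity comparable. -/
theorem coe_pairing₃_snoc (y : adj.TensorSq) (h : End (σ.comp l)) :
    (adj.pairing₃ (BalTensor.snoc y h) : B) = σ (adj.e * l h) * adj.pairing y := by
  induction y using BalTensor.induction with
  | h0 => simp
  | ha y z hy hz => simp [hy, hz, mul_add]
  | ht h₁ h₂ =>
    change σ (adj.e * l (σ (adj.e * l h) * h₂)) * h₁
      = σ (adj.e * l h) * (σ (adj.e * l h₂) * h₁)
    rw [← mul_assoc, ← map_mul, map_mul l, adj.e_rel_assoc]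

theorem contract_pairing₃ (h h' h'' : End (σ.comp l)) (q : Hom σ ((σ.comp l).comp σ)) :
    adj.contract (adj.insert ((σ.comp l).comp (σ.comp l)) q)
        (adj.pairing₃ (BalTensor₃.tmul _ _ _ _ h h' h''))
      = adj.pairing (adj.tmulSq h (adj.targetHom (op (adj.coord h'' q)) * h')) := by
  rw [← contract_pairing]
  ext
  change σ adj.e * (σ (adj.e * l (σ (adj.e * l h'') * h')) * h) * σ (l (σ (l (q * adj.m))))
    = σ (adj.e * l (σ adj.e * (σ (adj.e * l h'') * h') * σ (l (q * adj.m)))) * h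
  rw [mul_assoc, mul_assoc, endComp_comm, mul_assoc (σ adj.e) _ (σ _), map_mul l (σ adj.e),
    adj.e_rel_assoc, map_mul l _ (σ _)]
  simp only [map_mul, mul_assoc]

/-- The left inverse contracts with `q_i`, which absorbs the coordinates of the third factor into
the second. It then applies the inverse of the double pairing and appends `p_i σl(m)`. -/
theorem pairing₃_injective {ι : Type} [Fintype ι] {p q : ι → B}
    (hpq : IsSummandDiagram ((σ.comp l).comp σ) σ p q) : Function.Injective adj.pairing₃ := by
  refine BalTensor₃.injective_of_section
    (∑ i, (BalTensor.snoc.flip (adj.leg₂ ⟨p i, hpq.left i⟩)).comp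
      ((adj.copairing hpq).comp
        (adj.contract (adj.insert ((σ.comp l).comp (σ.comp l)) ⟨q i, hpq.right i⟩)))) ?_
  intro h h' h''
  rw [AddMonoidHom.finsetSum_apply]
  have key := congrArg (fun y : adj.TensorSq => (BalTensor.cons h y : adj.TensorCube))
    (adj.sum_target_tmulSq hpq h' h'')
  simp only [map_sum] at key
  refine Eq.trans (Finset.sum_congr rfl fun i _ => ?_) key
  change BalTensor.snoc (adj.copairing hpq (adj.contract _ (adj.pairing₃ _))) _ = _
  rw [contract_pairing₃, copairing_pairing]
  rfl

/-- The 2-cell `h σ(e) : σlσl → σl`. -/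
def comulCell : End (σ.comp l) →+ Hom ((σ.comp l).comp (σ.comp l)) (σ.comp l) :=
  AddMonoidHom.mk' (fun h => ⟨h * σ adj.e, by
      intro b
      change (h : B) * σ adj.e * σ (l (σ (l b))) = σ (l b) * (h * σ adj.e)
      rw [mul_assoc, ← map_mul, adj.e_rel, map_mul, endComp_comm_assoc]⟩)
    (by intro h h'; ext; simp [add_mul])

/-- The counit `h ↦ σ(e) h m`. -/
def counit : End (σ.comp l) →+ End σ :=
  AddMonoidHom.mk' (fun h => ⟨σ adj.e * h * adj.m, by
      intro b
      rw [mul_assoc, adj.m_rel, mul_assoc, endComp_comm_assoc, ← mul_assoc, ← map_mul, adj.e_rel,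
        map_mul]
      simp only [mul_assoc]⟩)
    (by intro h h'; ext; simp [mul_add, add_mul])

theorem coe_counit (h : End (σ.comp l)) : (adj.counit h : B) = σ adj.e * h * adj.m := rfl

/-- The counit records how `h` acts on `m`. Both multiplicativity laws for the counit follow,
because `ε(h h')` depends on `h'` only through `h' m`. -/
theorem counit_mul_m (h : End (σ.comp l)) : (adj.counit h : B) * adj.m = h * adj.m := by
  rw [coe_counit, mul_assoc, adj.m_rel, mul_assoc, endComp_comm_assoc, ← mul_assoc, ← map_mul,
    adj.e_mul_map_m, map_one, one_mul]

theorem coe_counit_mul (h h' : End (σ.comp l)) :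
    (adj.counit (h * h') : B) = σ adj.e * h * (h' * adj.m) := by
  change σ adj.e * (h * h' : B) * adj.m = _
  simp only [mul_assoc]

theorem tensorSq_ext {ι : Type} [Fintype ι] {p q : ι → B}
    (hpq : IsSummandDiagram ((σ.comp l).comp σ) σ p q) {y z : adj.TensorSq}
    (h : (adj.pairing y : B) = adj.pairing z) : y = z :=
  adj.pairing_injective hpq (Subtype.ext h)

/-! ### The comultiplication and the bialgebroid axioms -/

section Summand

variable {ι : Type} [Fintype ι] {p q : ι → B} (hpq : IsSummandDiagram ((σ.comp l).comp σ) σ p q)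

theorem pairing_copairing (g : Hom ((σ.comp l).comp (σ.comp l)) (σ.comp l)) :
    adj.pairing (adj.copairing hpq g) = g := by
  ext
  rw [copairing_apply, coe_pairing_sum]
  -- The aim is to make `q_i` and `p_i` adjacent. The element `p_i σl(m)` commutes past the
  -- contracted cell. The spare `σ(e)` is carried through `g` and `q_i` to the `m` between them,
  -- where `σ(e) m = 1` removes both.
  have key : ∀ i, σ (adj.e * l (adj.leg₂ ⟨p i, hpq.left i⟩ : B))
      * (homEnd σ l (adj.contract (adj.insert (σ.comp l) ⟨q i, hpq.right i⟩) g) : B)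
      = σ adj.e * g * σ (l (q i * p i * σ (l adj.m))) := by
    intro i
    have hq : q i * σ adj.e = σ (l (σ adj.e)) * q i := hpq.right i adj.e
    have hp : p i * σ (l adj.m) = (adj.leg₂ ⟨p i, hpq.left i⟩ : B) := rfl
    have hg : (g : B) * σ (l (σ (l (σ adj.e)))) = σ (l (σ adj.e)) * g := g.2 (σ adj.e)
    rw [map_mul σ, mul_assoc, ← endComp_comm, mul_assoc (q i), hp]
    change σ adj.e * (σ adj.e * g * σ (l (q i * adj.m)) * σ (l _)) = _
    rw [mul_assoc, mul_assoc, ← mul_assoc, ← map_mul, ← adj.e_rel, map_mul, mul_assoc,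
      ← mul_assoc (σ (l (σ adj.e))), ← hg, mul_assoc, ← map_mul σ (l _) (l _), ← map_mul σ,
      ← map_mul l, ← map_mul l, ← mul_assoc (σ (l (σ adj.e))), ← mul_assoc (σ (l (σ adj.e))),
      ← hq, mul_assoc (q i) _ adj.m, adj.map_e_mul_m, mul_one, ← mul_assoc]
  simp only [key]
  rw [← Finset.mul_sum, ← map_sum, ← map_sum, ← Finset.sum_mul, hpq.sum_eq, one_mul]
  have hg : (g : B) * σ (l (σ (l adj.m))) = σ (l adj.m) * g := g.2 adj.m
  rw [mul_assoc, hg, ← mul_assoc, ← map_mul, adj.e_mul_map_m, map_one, one_mul]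

/-- The comultiplication of `End(σl)`. -/
def comul : End (σ.comp l) →+ adj.TensorSq := (adj.copairing hpq).comp adj.comulCell

theorem pairing_comul (h : End (σ.comp l)) :
    (adj.pairing (adj.comul hpq h) : B) = h * σ adj.e :=
  congrArg Subtype.val (adj.pairing_copairing hpq (adj.comulCell h))

theorem comul_eq (h : End (σ.comp l)) :
    adj.comul hpq h = ∑ i, adj.tmulSq (adj.leg₁ h ⟨q i, hpq.right i⟩)
      (adj.leg₂ ⟨p i, hpq.left i⟩) := by
  refine (adj.copairing_apply hpq (adj.comulCell h)).trans (Finset.sum_congr rfl fun i _ => ?_)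
  congr 2
  ext
  change σ adj.e * (h * σ adj.e) * σ (l (q i * adj.m))
    = σ adj.e * h * σ (adj.e * l (q i * adj.m))
  rw [map_mul σ adj.e]
  simp only [mul_assoc]

/-- The form in which `Δ` enters the axioms: one equation in `B`, valid for every representation of
`Δ(h)` by elementary tensors. -/
theorem sum_of_comul_eq {h : End (σ.comp l)} {n : ℕ} {a b : Fin n → End (σ.comp l)}
    (hab : adj.comul hpq h = ∑ i, adj.tmulSq (a i) (b i)) :
    ∑ i, σ (adj.e * l (b i)) * (a i : B) = h * σ adj.e := by
  rw [← adj.coe_pairing_sum, ← hab, pairing_comul]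

theorem comul_bimodule (h : End (σ.comp l)) (r r' : End σ) (n : ℕ)
    (a b : Fin n → End (σ.comp l)) (hab : adj.comul hpq h = ∑ i, adj.tmulSq (a i) (b i)) :
    adj.comul hpq (sourceHom σ l r * adj.targetHom (op r') * h)
      = ∑ i, adj.tmulSq (sourceHom σ l r * a i) (adj.targetHom (op r') * b i) := by
  refine adj.tensorSq_ext hpq ?_
  rw [pairing_comul, coe_pairing_sum]
  have key : ∀ i, σ (adj.e * l (adj.targetHom (op r') * b i : End (σ.comp l)))
      * (sourceHom σ l r * a i : End (σ.comp l)) = (r : B) * σ (adj.dual r')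
        * (σ (adj.e * l (b i)) * a i) := by
    intro i
    change σ (adj.e * l (σ (adj.dual r') * b i)) * (r * a i) = _
    rw [map_mul l, adj.e_rel_assoc, ← mul_assoc, ← end_comm, map_mul]
    simp only [mul_assoc]
  simp only [key]
  rw [← Finset.mul_sum, adj.sum_of_comul_eq hpq hab, ← mul_assoc]
  rfl

/-- The two sides pair to `h σ(e) σ(e)` and `h σ(e) σ(lσ(e))`, and `e lσ(e) = e e`. -/
theorem comul_coassoc (h : End (σ.comp l)) (n : ℕ) (a b : Fin n → End (σ.comp l))
    (hab : adj.comul hpq h = ∑ i, adj.tmulSq (a i) (b i)) :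
    (∑ i, BalTensor.snoc (adj.comul hpq (a i)) (b i) : adj.TensorCube)
      = ∑ i, BalTensor.cons (a i) (adj.comul hpq (b i)) := by
  refine adj.pairing₃_injective hpq (Subtype.ext ?_)
  rw [map_sum, map_sum, AddSubmonoidClass.coe_finsetSum, AddSubmonoidClass.coe_finsetSum]
  simp only [coe_pairing₃_snoc, coe_pairing₃_cons, pairing_comul]
  have key : ∀ i, σ (adj.e * l (b i * σ adj.e)) * (a i : B)
      = σ (adj.e * l (b i)) * a i * σ (l (σ adj.e)) := by
    intro i
    rw [map_mul l, ← mul_assoc adj.e, map_mul σ _ (l (σ _)), mul_assoc, mul_assoc, endComp_comm]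
  simp only [key, ← mul_assoc]
  rw [← Finset.sum_mul, ← Finset.sum_mul, adj.sum_of_comul_eq hpq hab, mul_assoc, mul_assoc,
    ← map_mul, ← map_mul, adj.e_rel]

/-- The sum is the paired form `h σ(e)` followed by `m`, so this counit law is the triangle identity
`σ(e) m = 1`. -/
theorem sum_source_counit (h : End (σ.comp l)) (n : ℕ) (a b : Fin n → End (σ.comp l))
    (hab : adj.comul hpq h = ∑ i, adj.tmulSq (a i) (b i)) :
    ∑ i, sourceHom σ l (adj.counit (a i)) * b i = h := by
  ext
  rw [AddSubmonoidClass.coe_finsetSum]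
  have key : ∀ i, ((sourceHom σ l (adj.counit (a i)) * b i : End (σ.comp l)) : B)
      = σ (adj.e * l (b i)) * a i * adj.m := by
    intro i
    change σ adj.e * a i * adj.m * b i = _
    rw [mul_assoc, adj.m_rel, mul_assoc, endComp_comm_assoc, map_mul]
    simp only [mul_assoc]
  simp only [key]
  rw [← Finset.sum_mul, adj.sum_of_comul_eq hpq hab, mul_assoc, adj.map_e_mul_m, mul_one]

/-- Here `h σ(e)` is followed by `σl(m)`, and the other triangle identity applies. -/
theorem sum_target_counit (h : End (σ.comp l)) (n : ℕ) (a b : Fin n → End (σ.comp l))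
    (hab : adj.comul hpq h = ∑ i, adj.tmulSq (a i) (b i)) :
    ∑ i, adj.targetHom (op (adj.counit (b i))) * a i = h := by
  ext
  rw [AddSubmonoidClass.coe_finsetSum]
  have key : ∀ i, ((adj.targetHom (op (adj.counit (b i))) * a i : End (σ.comp l)) : B)
      = σ (adj.e * l (b i)) * a i * σ (l adj.m) := by
    intro i
    change σ (adj.dual (adj.counit (b i))) * a i = _
    rw [dual_eq, counit_mul_m, mul_assoc, endComp_comm, ← mul_assoc, ← map_mul, mul_assoc,
      ← map_mul]
  simp only [key]
  rw [← Finset.sum_mul, adj.sum_of_comul_eq hpq hab, mul_assoc, ← map_mul, adj.e_mul_map_m,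
    map_one, mul_one]

theorem comul_takeuchi (h : End (σ.comp l)) (r : End σ) (n : ℕ) (a b : Fin n → End (σ.comp l))
    (hab : adj.comul hpq h = ∑ i, adj.tmulSq (a i) (b i)) :
    ∑ i, adj.tmulSq (a i * adj.targetHom (op r)) (b i)
      = ∑ i, adj.tmulSq (a i) (b i * sourceHom σ l r) := by
  refine adj.tensorSq_ext hpq ?_
  rw [coe_pairing_sum, coe_pairing_sum]
  have key : ∀ i, σ (adj.e * l (b i * sourceHom σ l r : End (σ.comp l))) * (a i : B)
      = σ (adj.e * l (b i)) * a i * σ (l r) := by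
    intro i
    change σ (adj.e * l ((b i : B) * r)) * (a i : B) = _
    rw [map_mul l, ← mul_assoc, map_mul, mul_assoc, ← endComp_comm, ← mul_assoc]
  have key' : ∀ i, σ (adj.e * l (b i)) * ((a i * adj.targetHom (op r) : End (σ.comp l)) : B)
      = σ (adj.e * l (b i)) * a i * σ (adj.dual r) := fun i => (mul_assoc _ _ _).symm
  simp only [key, key']
  rw [← Finset.sum_mul, ← Finset.sum_mul, adj.sum_of_comul_eq hpq hab, mul_assoc, mul_assoc,
    ← map_mul, ← map_mul, adj.e_mul_dual]

theorem comul_one : adj.comul hpq 1 = adj.tmulSq 1 1 := by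
  refine adj.tensorSq_ext hpq ?_
  rw [pairing_comul, coe_pairing_tmul]
  simp

/-- Each `a_i` commutes with `σl(b'_j)`. Summing over `i` then produces `h σ(e)`, whose `σ(e)` is
what the sum over `j` needs to produce `h' σ(e)`. -/
theorem comul_mul (h h' : End (σ.comp l)) (n n' : ℕ) (a b : Fin n → End (σ.comp l))
    (a' b' : Fin n' → End (σ.comp l)) (hab : adj.comul hpq h = ∑ i, adj.tmulSq (a i) (b i))
    (hab' : adj.comul hpq h' = ∑ j, adj.tmulSq (a' j) (b' j)) :
    adj.comul hpq (h * h') = ∑ i, ∑ j, adj.tmulSq (a i * a' j) (b i * b' j) := by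
  refine adj.tensorSq_ext hpq ?_
  rw [pairing_comul, map_sum, AddSubmonoidClass.coe_finsetSum]
  simp only [coe_pairing_sum]
  have key : ∀ i j, σ (adj.e * l (b i * b' j : End (σ.comp l)))
      * ((a i * a' j : End (σ.comp l)) : B)
      = σ (adj.e * l (b i)) * a i * (σ (l (b' j)) * a' j) := by
    intro i j
    change σ (adj.e * l ((b i : B) * b' j)) * ((a i : B) * a' j) = _
    simp only [map_mul, mul_assoc, endComp_comm_assoc]
  have key' : ∀ j, (h : B) * σ adj.e * (σ (l (b' j)) * a' j)
      = h * (σ (adj.e * l (b' j)) * a' j) := by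
    intro j
    rw [map_mul σ]
    simp only [mul_assoc]
  simp only [key]
  rw [Finset.sum_comm]
  simp only [← Finset.sum_mul]
  rw [adj.sum_of_comul_eq hpq hab]
  simp only [key']
  rw [← Finset.mul_sum, adj.sum_of_comul_eq hpq hab', ← mul_assoc]
  rfl

theorem counit_bimodule (h : End (σ.comp l)) (r r' : End σ) :
    adj.counit (sourceHom σ l r * adj.targetHom (op r') * h) = r * adj.counit h * r' := by
  ext
  change σ adj.e * (r * σ (adj.dual r') * h) * adj.m = r * (σ adj.e * h * adj.m) * r'
  rw [mul_assoc (r : B), ← mul_assoc (σ adj.e), ← end_comm, mul_assoc (r : B),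
    ← mul_assoc (σ adj.e), ← map_mul, adj.e_mul_dual, map_mul, mul_assoc (σ adj.e), ← endComp_comm]
  simp only [mul_assoc, adj.m_rel]

theorem counit_one : adj.counit 1 = 1 := by
  ext
  rw [coe_counit, OneMemClass.coe_one, mul_one, adj.map_e_mul_m]
  rfl

/-- The left bialgebroid `End(σl)` over `End(σ)`. -/
def endBialgebroid : LeftBialgebroid (End σ) (End (σ.comp l)) where
  s := sourceHom σ l
  t := adj.targetHom
  s_mul_t r r' := Subtype.ext (end_comm r _)
  Δ := adj.comul hpq
  ε := adj.counit
  Δ_bimodule := adj.comul_bimodule hpq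
  ε_bimodule := adj.counit_bimodule
  coassoc := adj.comul_coassoc hpq
  counit_left := adj.sum_source_counit hpq
  counit_right := adj.sum_target_counit hpq
  takeuchi := adj.comul_takeuchi hpq
  Δ_one := adj.comul_one hpq
  Δ_mul := adj.comul_mul hpq
  ε_one := adj.counit_one
  ε_mul_s h h' := Subtype.ext <| by
    rw [coe_counit_mul, coe_counit_mul, coe_sourceHom, counit_mul_m]
  ε_mul_t h h' := Subtype.ext <| by
    rw [coe_counit_mul, coe_counit_mul, coe_targetHom, map_dual_mul_m, counit_mul_m]

theorem isEndBialgebroid : IsEndBialgebroid adj (adj.endBialgebroid hpq) where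
  source _ := rfl
  target _ := rfl
  comul p' q' hpq' h := by
    refine Eq.trans ?_ (adj.comul_eq hpq' h)
    exact adj.tensorSq_ext hpq ((adj.pairing_comul hpq h).trans (adj.pairing_comul hpq' h).symm)
  counit _ := rfl

end Summand

/-- The cells `e l(b_i) : l → id` and `a_i m : id → l` satisfy `e l(b_i) a_i m = a_i b_i`, so `id ≤
l`. Conjugating by their images under `σ` is `S`-bilinear because `S` commutes with `σ(B)`. -/
theorem sourceHom_isSplit (h1 : Le 1 σ) (adj : Adj l σ) : IsSplit (sourceHom σ l) := by
  obtain ⟨ι, _, b, a, hab⟩ := h1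
  have hb : ∀ i c, b i * c = σ c * b i := hab.left
  have ha : ∀ i c, a i * σ c = c * a i := hab.right
  let f : ι → End (σ.comp l) → End σ := fun i h =>
    ⟨σ (adj.e * l (b i)) * h * σ (a i * adj.m), by
      intro c
      rw [mul_assoc, ← map_mul, mul_assoc (a i), adj.m_rel, ← mul_assoc (a i), ha, mul_assoc (l c),
        map_mul σ (l c), mul_assoc, endComp_comm_assoc, ← mul_assoc, ← map_mul, mul_assoc adj.e,
        ← map_mul, hb, map_mul l, adj.e_rel_assoc, map_mul σ c]
      simp only [mul_assoc]⟩
  refine ⟨AddMonoidHom.mk' (fun h => ∑ i, f i h) ?_, ?_, ?_⟩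
  · intro h h'
    rw [← Finset.sum_add_distrib]
    refine Finset.sum_congr rfl fun i _ => Subtype.ext ?_
    change σ (adj.e * l (b i)) * (h + h' : B) * σ (a i * adj.m) = σ (adj.e * l (b i)) * h
      * σ (a i * adj.m) + σ (adj.e * l (b i)) * h' * σ (a i * adj.m)
    rw [mul_add, add_mul]
  · intro r r' h
    change ∑ i, f i _ = r * (∑ i, f i h) * r'
    rw [Finset.mul_sum, Finset.sum_mul]
    refine Finset.sum_congr rfl fun i _ => Subtype.ext ?_
    change σ (adj.e * l (b i)) * (r * h * r') * σ (a i * adj.m)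
      = r * (σ (adj.e * l (b i)) * h * σ (a i * adj.m)) * r'
    simp only [mul_assoc, end_comm, end_comm_assoc]
  · ext
    change ((∑ i, f i 1 : End σ) : B) = 1
    rw [AddSubmonoidClass.coe_finsetSum]
    have key : ∀ i, (f i 1 : B) = σ (a i * b i) := by
      intro i
      change σ (adj.e * l (b i)) * 1 * σ (a i * adj.m) = _
      rw [mul_one, ← map_mul, mul_assoc, ← mul_assoc (l (b i)), ← ha, mul_assoc, ← adj.m_rel,
        ← mul_assoc, ← ha, mul_assoc, adj.map_e_mul_m_assoc]
    simp only [key]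
    rw [← map_sum, hab.sum_eq, map_one]

end Adj
end Bialgebroid
/-! ### The comodule algebra of an `End(σ)`-ring isomorphic to `B` -/

section Comodule

variable {B : Type u} [Ring B] {l σ : B →+* B} (adj : Adj l σ)
  {A : Type v} [Ring A] {π : End σ →+* A} {Ψ : A ≃+* B} (hΨ : ∀ r, Ψ (π r) = r)

namespace Adj

/-- The tensor product `A ⊗_S H` for `H = End(σl)` and an `S`-ring `π : S → A`, `S = End(σ)`. -/
abbrev TensorMod (l : B →+* B) (π : End σ →+* A) : Type (max u v) :=
  BalTensor (fun (a : A) (r : End σ) => a * π r)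
    (fun (r : End σ) (h : End (σ.comp l)) => sourceHom σ l r * h)

/-- The tensor product `A ⊗_S H ⊗_S H`. -/
abbrev TensorModSq (π : End σ →+* A) : Type (max u v) :=
  BalTensor₃ (fun (a : A) (r : End σ) => a * π r)
    (fun (r : End σ) (h : End (σ.comp l)) => sourceHom σ l r * h)
    (fun (h : End (σ.comp l)) (r : End σ) => adj.targetHom (op r) * h)
    (fun (r : End σ) (h : End (σ.comp l)) => sourceHom σ l r * h)

/-- The elementary tensor `a ⊗ h` in `A ⊗_S H`. -/
abbrev tmulMod (l : B →+* B) (π : End σ →+* A) : A →+ End (σ.comp l) →+ TensorMod l π :=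
  BalTensor.tmul _ _

/-- The map `A ⊗_S H → B`, `a ⊗ h ↦ Ψ(a) σ(e) h`. -/
def modPairing : TensorMod l π →+ B :=
  BalTensor.lift
    (AddMonoidHom.mk' (fun a => (AddMonoidHom.mulLeft (Ψ a * σ adj.e)).comp
        (End (σ.comp l)).toAddSubgroup.subtype)
      (by intro a a'; ext h; simp [add_mul]))
    (by
      intro a r h
      change Ψ (a * π r) * σ adj.e * h = Ψ a * σ adj.e * (r * h)
      rw [map_mul, hΨ]
      simp only [mul_assoc, end_comm_assoc])

theorem modPairing_tmul (a : A) (h : End (σ.comp l)) :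
    adj.modPairing hΨ (tmulMod l π a h) = Ψ a * σ adj.e * h := rfl

theorem modPairing_sum {ι : Type} [Fintype ι] (x : ι → A) (y : ι → End (σ.comp l)) :
    adj.modPairing hΨ (∑ i, tmulMod l π (x i) (y i)) = ∑ i, Ψ (x i) * σ adj.e * y i := by
  rw [map_sum]
  rfl

section Summand

variable {ι : Type} [Fintype ι] {p q : ι → B} (hpq : IsSummandDiagram ((σ.comp l).comp σ) σ p q)

/-- The inverse `z ↦ ∑ Ψ⁻¹(z q_i) ⊗ p_i σl(m)` of the pairing `A ⊗_S H → B`. -/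
def modCopairing (Ψ : A ≃+* B) : B →+ TensorMod l π :=
  ∑ i, ((tmulMod l π).flip (adj.leg₂ ⟨p i, hpq.left i⟩)).comp
    ((Ψ.symm : B →+ A).comp (AddMonoidHom.mulRight (q i)))

theorem modCopairing_apply (z : B) :
    adj.modCopairing hpq Ψ z
      = ∑ i, tmulMod l π (Ψ.symm (z * q i)) (adj.leg₂ ⟨p i, hpq.left i⟩) := by
  rw [modCopairing, AddMonoidHom.finsetSum_apply]
  rfl

theorem modPairing_modCopairing (z : B) :
    adj.modPairing hΨ (adj.modCopairing hpq Ψ z) = z := by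
  rw [modCopairing_apply, modPairing_sum]
  have key : ∀ i, Ψ (Ψ.symm (z * q i)) * σ adj.e * (adj.leg₂ ⟨p i, hpq.left i⟩ : B)
      = z * (q i * p i) := by
    intro i
    have hp : p i * σ (l (σ adj.e)) = σ adj.e * p i := hpq.left i adj.e
    change _ * (p i * σ (l adj.m)) = _
    rw [Ψ.apply_symm_apply, mul_assoc, ← mul_assoc _ (p i), ← hp, mul_assoc (p i), ← map_mul σ,
      ← map_mul l, adj.map_e_mul_m, map_one, map_one, mul_one, mul_assoc]
  simp only [key]
  rw [← Finset.mul_sum, hpq.sum_eq, mul_one]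

/-- Again the dual basis: the coordinates `σ(e) h q_i` of `h` are moved across the tensor sign into
`A`. -/
theorem modCopairing_modPairing (a : A) (h : End (σ.comp l)) :
    adj.modCopairing hpq Ψ (adj.modPairing hΨ (tmulMod l π a h)) = tmulMod l π a h := by
  rw [modCopairing_apply]
  conv_rhs => rw [← adj.sum_coord_mul_leg₂ hpq h, map_sum]
  refine Finset.sum_congr rfl fun i _ => Eq.trans ?_ (BalTensor.tmul_rel a _ _)
  congr 2
  apply Ψ.injective
  rw [Ψ.apply_symm_apply, map_mul, hΨ, modPairing_tmul]
  change _ = _ * (σ adj.e * h * q i)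
  simp only [mul_assoc]

end Summand

theorem modPairing_bijective {ι : Type} [Fintype ι] {p q : ι → B}
    (hpq : IsSummandDiagram ((σ.comp l).comp σ) σ p q) :
    Function.Bijective (adj.modPairing hΨ) :=
  ⟨BalTensor.injective_of_section _ (adj.modCopairing_modPairing hΨ hpq),
    Function.RightInverse.surjective (adj.modPairing_modCopairing hΨ hpq)⟩

/-- The map `A ⊗_S H ⊗_S H → B`, `a ⊗ h ⊗ h' ↦ Ψ(a) σ(e) σ(e l(h')) h`. -/
def modPairing₃ : adj.TensorModSq π →+ B :=
  BalTensor₃.lift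
    (AddMonoidHom.mk' (fun a => (AddMonoidHom.mulLeft (Ψ a * σ adj.e)).comp
        ((Hom ((σ.comp l).comp (σ.comp l)) (σ.comp l)).subtype.comp adj.pairing))
      (by intro a a'; ext h; simp [add_mul]))
    (by
      intro a r h h'
      change Ψ (a * π r) * σ adj.e * (σ (adj.e * l h') * h)
        = Ψ a * σ adj.e * (σ (adj.e * l h') * (r * h))
      rw [map_mul, hΨ]
      simp only [mul_assoc, end_comm_assoc])

theorem modPairing₃_cons (a : A) (y : adj.TensorSq) :
    adj.modPairing₃ hΨ (BalTensor.cons a y) = Ψ a * σ adj.e * adj.pairing y :=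
  BalTensor₃.lift_cons _ _ a y

theorem modPairing₃_snoc (y : TensorMod l π) (h : End (σ.comp l)) :
    adj.modPairing₃ hΨ (BalTensor.snoc y h) = adj.modPairing hΨ y * σ (l (σ adj.e * h)) := by
  induction y using BalTensor.induction with
  | h0 => simp
  | ha y z hy hz => simp [hy, hz, add_mul]
  | ht a h' =>
    change Ψ a * σ adj.e * (σ (adj.e * l h) * h') = Ψ a * σ adj.e * h' * σ (l (σ adj.e * h))
    rw [mul_assoc _ (h' : B), endComp_comm, ← mul_assoc, ← mul_assoc, mul_assoc (Ψ a),
      mul_assoc (Ψ a), ← map_mul, adj.e_mul_e]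
    simp only [map_mul, mul_assoc]

theorem modPairing₃_mul (a : A) (h h' : End (σ.comp l)) (q : Hom σ ((σ.comp l).comp σ)) :
    adj.modPairing₃ hΨ (BalTensor₃.tmul _ _ _ _ a h h') * σ (l q)
      = adj.modPairing hΨ (tmulMod l π a (adj.targetHom (op (adj.coord h' q)) * h)) := by
  change Ψ a * σ adj.e * (σ (adj.e * l h') * h) * σ (l q)
    = Ψ a * σ adj.e * (σ (adj.dual (adj.coord h' q)) * h)
  rw [← mul_assoc _ (σ (adj.dual _)), mul_assoc (Ψ a) _ (σ (adj.dual _)), ← map_mul, e_mul_dual]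
  change _ = Ψ a * σ (adj.e * l (σ adj.e * h' * q)) * h
  rw [mul_assoc (σ adj.e), ← adj.e_mul_e]
  simp only [map_mul, mul_assoc, endComp_comm]

/-- Right multiplication by `σ(l(q_i))` absorbs the coordinates of the last factor. This reduces the
claim to the inverse for `A ⊗_S H`. -/
theorem modPairing₃_injective {ι : Type} [Fintype ι] {p q : ι → B}
    (hpq : IsSummandDiagram ((σ.comp l).comp σ) σ p q) :
    Function.Injective (adj.modPairing₃ hΨ) := by
  refine BalTensor₃.injective_of_section
    (∑ i, (BalTensor.snoc.flip (adj.leg₂ ⟨p i, hpq.left i⟩)).comp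
      ((adj.modCopairing hpq Ψ).comp (AddMonoidHom.mulRight (σ (l (q i)))))) ?_
  intro a h h'
  rw [AddMonoidHom.finsetSum_apply]
  have key := congrArg (fun y : adj.TensorSq => (BalTensor.cons a y : adj.TensorModSq π))
    (adj.sum_target_tmulSq hpq h h')
  simp only [map_sum] at key
  refine Eq.trans (Finset.sum_congr rfl fun i _ => ?_) key
  change BalTensor.snoc (adj.modCopairing hpq Ψ (adj.modPairing₃ hΨ _ * σ (l (q i)))) _ = _
  rw [adj.modPairing₃_mul hΨ a h h' ⟨q i, hpq.right i⟩, modCopairing_modPairing]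
  rfl

/-! ### The coaction -/

section Summand

variable {ι : Type} [Fintype ι] {p q : ι → B} (hpq : IsSummandDiagram ((σ.comp l).comp σ) σ p q)

/-- The map `y ↦ σ(e l(y))` on `B`. -/
def coactCell : B →+ B :=
  AddMonoidHom.mk' (fun y => σ (adj.e * l y)) (by intro y z; simp [mul_add])

/-- The coaction `A → A ⊗_S H`. -/
def coact (Ψ : A ≃+* B) : A →+ TensorMod l π :=
  (adj.modCopairing hpq Ψ).comp (adj.coactCell.comp (Ψ : A →+ B))

theorem modPairing_coact (a : A) :
    adj.modPairing hΨ (adj.coact hpq Ψ a) = σ (adj.e * l (Ψ a)) :=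
  adj.modPairing_modCopairing hΨ hpq _

theorem sum_of_coact_eq (hΨ : ∀ r, Ψ (π r) = r) {a : A} {n : ℕ}
    {x : Fin n → A} {y : Fin n → End (σ.comp l)}
    (hxy : adj.coact hpq Ψ a = ∑ i, tmulMod l π (x i) (y i)) :
    ∑ i, Ψ (x i) * σ adj.e * y i = σ (adj.e * l (Ψ a)) := by
  rw [← adj.modPairing_sum hΨ, ← hxy, modPairing_coact]

theorem coact_bimodule (hΨ : ∀ r, Ψ (π r) = r) (a : A) (r r' : End σ) (n : ℕ) (x : Fin n → A)
    (y : Fin n → End (σ.comp l)) (hxy : adj.coact hpq Ψ a = ∑ i, tmulMod l π (x i) (y i)) :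
    adj.coact hpq Ψ (π r' * a * π r)
      = ∑ i, tmulMod l π (x i) (adj.targetHom (op r) * y i * adj.targetHom (op r')) := by
  refine (adj.modPairing_bijective hΨ hpq).1 ?_
  rw [modPairing_coact, modPairing_sum, map_mul Ψ, map_mul Ψ, hΨ, hΨ]
  have key : ∀ i, Ψ (x i) * σ adj.e
      * ((adj.targetHom (op r) * y i * adj.targetHom (op r') : End (σ.comp l)) : B)
      = Ψ (x i) * σ adj.e * y i * σ (l r * adj.dual r') := by
    intro i
    change _ * (σ (adj.dual r) * y i * σ (adj.dual r')) = _
    rw [mul_assoc, ← mul_assoc (σ adj.e), ← mul_assoc (σ adj.e), ← map_mul, e_mul_dual,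
      map_mul σ (l r)]
    simp only [map_mul, mul_assoc, endComp_comm_assoc]
  simp only [key]
  rw [← Finset.sum_mul, adj.sum_of_coact_eq hpq hΨ hxy, ← map_mul, ← dual_comm,
    mul_assoc (r' : B), map_mul l, ← mul_assoc adj.e (l r'), ← e_mul_dual, mul_assoc, map_mul l,
    ← mul_assoc (adj.dual _), dual_comm]
  simp only [mul_assoc]

/-- With `z = e l(Ψ(a))`, the two sides become `σ(e lσ(z))` and `σ(z) σ(e)`, which agree by the
intertwining relation of `e`. -/
theorem coact_coassoc (hΨ : ∀ r, Ψ (π r) = r) (a : A) (n : ℕ)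
    (x : Fin n → A) (y : Fin n → End (σ.comp l))
    (hxy : adj.coact hpq Ψ a = ∑ i, tmulMod l π (x i) (y i)) :
    (∑ i, BalTensor.snoc (adj.coact hpq Ψ (x i)) (y i) : adj.TensorModSq π)
      = ∑ i, BalTensor.cons (x i) (adj.comul hpq (y i)) := by
  refine adj.modPairing₃_injective hΨ hpq ?_
  rw [map_sum, map_sum]
  simp only [modPairing₃_snoc, modPairing₃_cons, modPairing_coact, pairing_comul]
  have key : ∀ i, σ (adj.e * l (Ψ (x i))) * σ (l (σ adj.e * y i))
      = σ (adj.e * l (Ψ (x i) * σ adj.e * y i)) := by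
    intro i
    simp only [map_mul, mul_assoc]
  simp only [key, ← mul_assoc]
  rw [← Finset.sum_mul, ← map_sum, ← Finset.mul_sum, ← map_sum, adj.sum_of_coact_eq hpq hΨ hxy,
    adj.e_rel, map_mul]

theorem coact_counit (hΨ : ∀ r, Ψ (π r) = r) (a : A) (n : ℕ)
    (x : Fin n → A) (y : Fin n → End (σ.comp l))
    (hxy : adj.coact hpq Ψ a = ∑ i, tmulMod l π (x i) (y i)) :
    ∑ i, x i * π (adj.counit (y i)) = a := by
  apply Ψ.injective
  rw [map_sum]
  simp only [map_mul, hΨ, coe_counit, ← mul_assoc]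
  rw [← Finset.sum_mul, adj.sum_of_coact_eq hpq hΨ hxy, adj.map_e_mul_map_mul_m]

/-- The paired coaction takes values in `σ(B)`, with which `r` commutes. -/
theorem coact_takeuchi (hΨ : ∀ r, Ψ (π r) = r)
    (a : A) (r : End σ) (n : ℕ) (x : Fin n → A) (y : Fin n → End (σ.comp l))
    (hxy : adj.coact hpq Ψ a = ∑ i, tmulMod l π (x i) (y i)) :
    ∑ i, tmulMod l π (π r * x i) (y i) = ∑ i, tmulMod l π (x i) (y i * sourceHom σ l r) := by
  refine (adj.modPairing_bijective hΨ hpq).1 ?_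
  rw [modPairing_sum, modPairing_sum]
  have key : ∀ i, Ψ (x i) * σ adj.e * ((y i * sourceHom σ l r : End (σ.comp l)) : B)
      = Ψ (x i) * σ adj.e * y i * r := fun i => (mul_assoc _ _ _).symm
  simp only [key, map_mul, hΨ, mul_assoc (r : B)]
  rw [← Finset.sum_mul, ← Finset.mul_sum, adj.sum_of_coact_eq hpq hΨ hxy, end_comm]

theorem coact_one (hΨ : ∀ r, Ψ (π r) = r) : adj.coact hpq Ψ 1 = tmulMod l π 1 1 := by
  refine (adj.modPairing_bijective hΨ hpq).1 ?_
  rw [modPairing_coact, modPairing_tmul]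
  simp

/-- The reversed product `y'_j y_i` nests the paired form of `δ(a')` inside that of `δ(a)`. The
inner sum is `σ(e) σ(l(Ψ(a')))`, and its second factor commutes past `y_i`. -/
theorem coact_mul (hΨ : ∀ r, Ψ (π r) = r)
    (a a' : A) (n n' : ℕ) (x : Fin n → A) (y : Fin n → End (σ.comp l))
    (x' : Fin n' → A) (y' : Fin n' → End (σ.comp l))
    (hxy : adj.coact hpq Ψ a = ∑ i, tmulMod l π (x i) (y i))
    (hxy' : adj.coact hpq Ψ a' = ∑ j, tmulMod l π (x' j) (y' j)) :
    adj.coact hpq Ψ (a * a') = ∑ i, ∑ j, tmulMod l π (x i * x' j) (y' j * y i) := by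
  refine (adj.modPairing_bijective hΨ hpq).1 ?_
  rw [modPairing_coact, map_sum]
  simp only [modPairing_sum]
  have key : ∀ i j, Ψ (x i * x' j) * σ adj.e * ((y' j * y i : End (σ.comp l)) : B)
      = Ψ (x i) * (Ψ (x' j) * σ adj.e * y' j) * y i := by
    intro i j
    rw [map_mul]
    change _ * ((y' j : B) * y i) = _
    simp only [mul_assoc]
  have key' : ∀ i, Ψ (x i) * σ (adj.e * l (Ψ a')) * y i
      = Ψ (x i) * σ adj.e * y i * σ (l (Ψ a')) := by
    intro i
    simp only [map_mul, mul_assoc, endComp_comm]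
  simp only [key]
  simp only [← Finset.sum_mul, ← Finset.mul_sum]
  rw [adj.sum_of_coact_eq hpq hΨ hxy']
  simp only [key']
  rw [← Finset.sum_mul, adj.sum_of_coact_eq hpq hΨ hxy, ← map_mul σ, map_mul Ψ, map_mul l,
    mul_assoc]

/-- The right comodule algebra structure of an `End(σ)`-ring isomorphic to `B`. -/
def comoduleAlgebra : RightComoduleAlgebra (adj.endBialgebroid hpq) A where
  π := π
  δ := adj.coact hpq Ψ
  δ_bimodule := adj.coact_bimodule hpq hΨ
  coassoc := adj.coact_coassoc hpq hΨ
  counit := adj.coact_counit hpq hΨ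
  takeuchi := adj.coact_takeuchi hpq hΨ
  δ_one := adj.coact_one hpq hΨ
  δ_mul := adj.coact_mul hpq hΨ

end Summand

end Adj
end Comodule
/-! ### The Galois property -/

section Galois

variable {B : Type u} [Ring B] {l σ : B →+* B} (adj : Adj l σ)
  {A : Type v} [Ring A] {π : End σ →+* A} {Ψ : A ≃+* B}

namespace Adj

/-- The map `A ⊗_B A → B`, `a ⊗ a' ↦ Ψ(a) σ(e l(Ψ(a')))`. -/
def squareMap {ρ : B →+* A} (hρ : ∀ b, Ψ (ρ b) = σ b) :
    BalTensor (fun (a : A) (b : B) => a * ρ b) (fun (b : B) (a : A) => ρ b * a) →+ B :=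
  BalTensor.lift
    (AddMonoidHom.mk' (fun a => (AddMonoidHom.mulLeft (Ψ a)).comp (adj.coactCell.comp (Ψ : A →+ B)))
      (by intro a a'; ext x; simp [add_mul]))
    (by
      intro a b a'
      change Ψ (a * ρ b) * σ (adj.e * l (Ψ a')) = Ψ a * σ (adj.e * l (Ψ (ρ b * a')))
      rw [map_mul Ψ, map_mul Ψ, hρ, map_mul l, adj.e_rel_assoc, map_mul σ b, mul_assoc])

/-- As a left `B`-module `A` is generated by the element corresponding to `m`, since `y = σ(e l(y))
m`. Hence each tensor can be rewritten with second factor `m`, and `e l(m) = 1` gives surjectivity.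
-/
theorem squareMap_bijective {ρ : B →+* A} (hρ : ∀ b, Ψ (ρ b) = σ b) :
    Function.Bijective (adj.squareMap hρ) := by
  refine ⟨BalTensor.injective_of_section
    (((BalTensor.tmul _ _).flip (Ψ.symm adj.m)).comp (Ψ.symm : B →+ A)) ?_, fun z => ?_⟩
  · intro a a'
    change BalTensor.tmul _ _ (Ψ.symm (Ψ a * σ (adj.e * l (Ψ a')))) (Ψ.symm adj.m) = _
    have h1 : Ψ.symm (Ψ a * σ (adj.e * l (Ψ a'))) = a * ρ (adj.e * l (Ψ a')) := by
      rw [Ψ.symm_apply_eq, map_mul Ψ, hρ]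
    have h2 : ρ (adj.e * l (Ψ a')) * Ψ.symm adj.m = a' := by
      apply Ψ.injective
      rw [map_mul, hρ, Ψ.apply_symm_apply, adj.map_e_mul_map_mul_m]
    rw [h1]
    exact (BalTensor.tmul_rel a _ _).trans (congrArg (BalTensor.tmul _ _ a) h2)
  · refine ⟨BalTensor.tmul _ _ (Ψ.symm z) (Ψ.symm adj.m), ?_⟩
    change Ψ (Ψ.symm z) * σ (adj.e * l (Ψ (Ψ.symm adj.m))) = z
    rw [Ψ.apply_symm_apply, Ψ.apply_symm_apply, adj.e_mul_map_m, map_one, mul_one]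

/-- If `id ≤ σ`, then `σ(B)` consists of the `y` with `σ(e l(y)) = y σ(e)`. -/
theorem mem_range_of_coactCell (h1 : Le 1 σ) {y : B} (hy : σ (adj.e * l y) = y * σ adj.e) :
    ∃ b, σ b = y := by
  obtain ⟨ι, _, b, a, hab⟩ := h1
  have ha : ∀ i c, a i * σ c = c * a i := hab.right
  -- A right inverse of `e`, built from the mates that exhibit `id ≤ l`. Cancelling `σ(e)` with its
  -- image under `σ` writes `y` as a value of `σ`.
  have hev : adj.e * ∑ i, l (b i) * (a i * adj.m) = 1 := by
    rw [Finset.mul_sum, ← hab.sum_eq]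
    refine Finset.sum_congr rfl fun i _ => ?_
    rw [← mul_assoc (l (b i)), ← ha, mul_assoc, ← adj.m_rel, ← mul_assoc, ← ha, mul_assoc,
      adj.map_e_mul_m_assoc]
  refine ⟨adj.e * l y * ∑ i, l (b i) * (a i * adj.m), ?_⟩
  rw [map_mul, hy, mul_assoc, ← map_mul, hev, map_one, mul_one]

theorem comoduleAlgebra_isGalois {ι : Type} [Fintype ι] {p q : ι → B}
    (hpq : IsSummandDiagram ((σ.comp l).comp σ) σ p q) (hΨ : ∀ r, Ψ (π r) = r)
    {ρ : B →+* A} (hρ : ∀ b, Ψ (ρ b) = σ b) (h1 : Le 1 σ) :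
    (adj.comoduleAlgebra hΨ hpq).IsGalois ρ := by
  have hbij := adj.modPairing_bijective hΨ hpq
  refine ⟨fun a => ?_, ?_⟩
  · change adj.coact hpq Ψ a = tmulMod l π a 1 ↔ _
    rw [← hbij.1.eq_iff, modPairing_coact, modPairing_tmul, OneMemClass.coe_one, mul_one]
    constructor
    · intro h
      obtain ⟨b, hb⟩ := adj.mem_range_of_coactCell h1 h
      exact ⟨b, Ψ.injective ((hρ b).trans hb)⟩
    · rintro ⟨b, rfl⟩
      rw [hρ, adj.e_rel, map_mul]
  · let Θ : TensorMod l π ≃+ B := AddEquiv.ofBijective (adj.modPairing hΨ) hbij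
    have hΘ : ∀ y, adj.modPairing hΨ (Θ.symm y) = y := Θ.apply_symm_apply
    refine ⟨Θ.symm.toAddMonoidHom.comp (adj.squareMap hρ), ?_,
      Θ.symm.bijective.comp (adj.squareMap_bijective hρ)⟩
    intro a a'
    apply hbij.1
    -- The pairing `A ⊗_S H → B` is left `A`-linear, so the paired value of `a δ(a')` is `Ψ(a) σ(e
    -- l(Ψ(a')))`.
    let L : TensorMod l π →+ TensorMod l π := (adj.comoduleAlgebra hΨ hpq).lmul a
    have hL : (adj.modPairing hΨ).comp L
        = (AddMonoidHom.mulLeft (Ψ a)).comp (adj.modPairing hΨ) := by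
      refine BalTensor.hom_ext fun x h => ?_
      change Ψ (a * x) * σ adj.e * h = Ψ a * (Ψ x * σ adj.e * h)
      rw [map_mul]
      simp only [mul_assoc]
    refine (hΘ _).trans (Eq.trans ?_ (DFunLike.congr_fun hL (adj.coact hpq Ψ a')).symm)
    exact congrArg (Ψ a * ·) (adj.modPairing_coact hΨ hpq a').symm

end Adj
end Galois

/-! ### The field algebra of `Hom(σ, σ _)` -/

section FieldAlgebraOfHom

variable {B : Type u} [Ring B] {l σ : B →+* B}

/-- The evaluation `b ⊗_α x ↦ σ(b) x`. -/
noncomputable def evalHom (σ : B →+* B) (C : Submonoid (B →+* B)) :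
    FieldAlgebra (homFunctor σ C) →+ B :=
  FieldAlgebra.lift
    (fun α => AddMonoidHom.mk' (fun b => (AddMonoidHom.mulLeft (σ b)).comp
        (Hom σ (σ.comp (α : B →+* B))).subtype)
      (by
        intro b b'
        ext x
        change σ (b + b') * (x : Hom σ (σ.comp (α : B →+* B))).1
          = σ b * (x : Hom σ (σ.comp (α : B →+* B))).1 + σ b' * (x : Hom σ (σ.comp (α : B →+* B))).1
        rw [map_add, add_mul]))
    (by
      intro α β t b x
      change σ (b * t) * (x : Hom σ (σ.comp (α : B →+* B))).1
        = σ b * (σ t * (x : Hom σ (σ.comp (α : B →+* B))).1)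
      rw [map_mul, mul_assoc])

theorem evalHom_word (C : Submonoid (B →+* B)) (α : C) (b : B)
    (x : Hom σ (σ.comp (α : B →+* B))) :
    evalHom σ C (FieldAlgebra.word (homFunctor σ C) α b (toObj α x)) = σ b * x :=
  FieldAlgebra.lift_word _ _ _ _ _

/-- On words this is the intertwining relation `x σ(b') = σα(b') x`. -/
theorem evalHom_mul (C : Submonoid (B →+* B)) (y z : FieldAlgebra (homFunctor σ C)) :
    evalHom σ C (y * z) = evalHom σ C y * evalHom σ C z := by
  induction y using FieldAlgebra.induction with
  | hz => simp
  | ha y y' hy hy' => rw [add_mul, map_add, map_add, hy, hy', add_mul]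
  | hw α b x =>
    induction z using FieldAlgebra.induction with
    | hz => simp
    | ha z z' hz hz' => rw [mul_add, map_add, map_add, hz, hz', mul_add]
    | hw β b' x' =>
      rw [FieldAlgebra.word_mul_word]
      have hx : (x : Hom σ (σ.comp (α : B →+* B))).1 * σ b'
        = σ ((α : B →+* B) b') * (x : Hom σ (σ.comp (α : B →+* B))).1 := x.2 b'
      have h1 := evalHom_word C (α * β) (b * (α : B →+* B) b')
        ((homFunctor σ C).mu x x' : Hom σ (σ.comp ((α * β : C) : B →+* B)))
      have h2 := evalHom_word C α b x
      have h3 := evalHom_word C β b' x'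
      refine h1.trans (Eq.trans ?_ (congrArg₂ (· * ·) h2 h3).symm)
      change σ (b * (α : B →+* B) b') * ((x : Hom σ (σ.comp (α : B →+* B))).1
          * (x' : Hom σ (σ.comp (β : B →+* B))).1)
        = σ b * (x : Hom σ (σ.comp (α : B →+* B))).1
          * (σ b' * (x' : Hom σ (σ.comp (β : B →+* B))).1)
      rw [map_mul, mul_assoc, mul_assoc, ← mul_assoc _ (σ b'), hx, mul_assoc]

/-- The 2-cell `m : σ → σlσ`. -/
def Adj.unitCell (adj : Adj l σ) : Hom σ (σ.comp (l.comp σ)) :=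
  ⟨adj.m, fun b => adj.m_rel (σ b)⟩

/-- The 2-cell `e l(x) : lσ → α` for `x : σ → σα`. -/
def Adj.transposeCell (adj : Adj l σ) {α : B →+* B} (x : Hom σ (σ.comp α)) : Hom (l.comp σ) α :=
  ⟨adj.e * l x, by
    intro b
    have hx : (x : B) * σ b = σ (α b) * x := x.2 b
    change adj.e * l x * l (σ b) = α b * (adj.e * l x)
    rw [mul_assoc, ← map_mul, hx, map_mul, adj.e_rel_assoc]⟩

/-- Yoneda: `x` is the image of `m` under the cell `e l(x) : lσ → α`, so the defining relation turns
`b e l(x) ⊗ m` into `b ⊗ x`. -/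
theorem word_evalHom (adj : Adj l σ) (C : Submonoid (B →+* B)) (hC : l.comp σ ∈ C)
    (y : FieldAlgebra (homFunctor σ C)) :
    FieldAlgebra.word (homFunctor σ C) ⟨l.comp σ, hC⟩ (adj.e * l (evalHom σ C y))
      (toObj ⟨l.comp σ, hC⟩ adj.unitCell) = y := by
  induction y using FieldAlgebra.induction with
  | hz => simp
  | ha y y' hy hy' =>
    rw [map_add, map_add, mul_add, map_add, AddMonoidHom.add_apply, hy, hy']
  | hw α b x =>
    have h1 : evalHom σ C (FieldAlgebra.word (homFunctor σ C) α b x)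
        = σ b * (x : Hom σ (σ.comp (α : B →+* B))).1 := evalHom_word C α b x
    rw [h1, map_mul l, adj.e_rel_assoc]
    refine (FieldAlgebra.word_rel (F := homFunctor σ C) (α := ⟨l.comp σ, hC⟩)
      (adj.transposeCell x) b (toObj ⟨l.comp σ, hC⟩ adj.unitCell)).trans ?_
    congr 1
    exact Subtype.ext (adj.map_e_mul_map_mul_m _)

/-- If `σ` has a left dual `l` with `lσ` in `C`, then `Hom(σ, σ _)` is represented by `lσ`, and
evaluation is an isomorphism from its field algebra to `B`. -/
noncomputable def evalEquiv (adj : Adj l σ) (C : Submonoid (B →+* B)) (hC : l.comp σ ∈ C) :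
    FieldAlgebra (homFunctor σ C) ≃+* B where
  toFun := evalHom σ C
  invFun z := FieldAlgebra.word (homFunctor σ C) ⟨l.comp σ, hC⟩ (adj.e * l z)
    (toObj ⟨l.comp σ, hC⟩ adj.unitCell)
  map_add' := map_add _
  map_mul' := evalHom_mul C
  right_inv z := (evalHom_word C ⟨l.comp σ, hC⟩ _ adj.unitCell).trans (adj.map_e_mul_map_mul_m z)
  left_inv := word_evalHom adj C hC

theorem evalEquiv_baseMap (adj : Adj l σ) (C : Submonoid (B →+* B)) (hC : l.comp σ ∈ C)
    (r : End σ) : evalEquiv adj C hC (baseMap σ C r) = r := by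
  refine (evalHom_word C 1 1 ⟨(r : B), mem_Hom.2 (mem_End.1 r.2)⟩).trans ?_
  rw [map_one, one_mul]

theorem evalEquiv_extension (adj : Adj l σ) (C : Submonoid (B →+* B)) (hC : l.comp σ ∈ C)
    (b : B) : evalEquiv adj C hC (FieldAlgebra.extension (homFunctor σ C) b) = σ b :=
  (evalHom_word C 1 b ⟨1, fun a => by simp⟩).trans (mul_one _)

/-- Once `ρ_F` is identified with `σ`, a summand diagram for `id ≤ σ` gives the splitting `y ↦ ∑ a_i
y b_i`. -/
theorem extension_isSplit (h1 : Le 1 σ) (adj : Adj l σ) (C : Submonoid (B →+* B))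
    (hC : l.comp σ ∈ C) : IsSplit (FieldAlgebra.extension (homFunctor σ C)) := by
  obtain ⟨ι, _, b, a, hab⟩ := h1
  have hb : ∀ i c, b i * c = σ c * b i := hab.left
  have ha : ∀ i c, a i * σ c = c * a i := hab.right
  let Ψ := evalEquiv adj C hC
  refine ⟨AddMonoidHom.mk' (fun y => ∑ i, a i * Ψ y * b i) ?_, ?_, ?_⟩
  · intro y z
    simp only [map_add, mul_add, add_mul, Finset.sum_add_distrib]
  · intro n n' y
    change ∑ i, a i * Ψ _ * b i = n * (∑ i, a i * Ψ y * b i) * n'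
    rw [Finset.mul_sum, Finset.sum_mul]
    refine Finset.sum_congr rfl fun i _ => ?_
    have h : Ψ (FieldAlgebra.extension (homFunctor σ C) n * y
        * FieldAlgebra.extension (homFunctor σ C) n') = σ n * Ψ y * σ n' := by
      rw [map_mul, map_mul, evalEquiv_extension, evalEquiv_extension]
    rw [h, mul_assoc (a i), mul_assoc _ (σ n'), ← hb, mul_assoc (σ n), ← mul_assoc (a i), ha]
    simp only [mul_assoc]
  · change ∑ i, a i * Ψ 1 * b i = 1
    simp only [map_one, mul_one, hab.sum_eq]

theorem isFieldCoaction (adj : Adj l σ) (C : Submonoid (B →+* B)) (hC : l.comp σ ∈ C)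
    {ι : Type} [Fintype ι] {p q : ι → B} (hpq : IsSummandDiagram ((σ.comp l).comp σ) σ p q) :
    IsFieldCoaction adj C (adj.comoduleAlgebra (evalEquiv_baseMap adj C hC) hpq) where
  base := rfl
  coaction α b x κ _ f y hfy := by
    refine (adj.modPairing_bijective (evalEquiv_baseMap adj C hC) hpq).1 ?_
    refine (adj.modPairing_coact _ hpq _).trans (Eq.trans ?_ (adj.modPairing_sum _ _ _).symm)
    have h1 : ∀ x, evalEquiv adj C hC (FieldAlgebra.word (homFunctor σ C) α b (toObj α x))
        = σ b * x := evalHom_word C α b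
    have key : ∀ i, evalEquiv adj C hC (FieldAlgebra.word (homFunctor σ C) α b
        (toObj α ⟨y i, hfy.right i⟩)) * σ adj.e * (adj.coeff ⟨f i, hfy.left i⟩ x : B)
        = σ b * (y i * f i) * (σ ((α : B →+* B) adj.e) * σ (adj.e * l (x * adj.m))) := by
      intro i
      have hf : f i * σ ((α : B →+* B) adj.e) = σ adj.e * f i := hfy.left i adj.e
      rw [h1]
      change σ b * y i * σ adj.e * (f i * σ (adj.e * l (x * adj.m))) = _
      rw [mul_assoc _ (σ adj.e), ← mul_assoc (σ adj.e), ← hf]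
      simp only [mul_assoc]
    simp only [key]
    -- What remains is `α(e) e l(x m) = e l(σα(e) x m) = e l(x σ(e) m) = e l(x)`, with `σ(b)` then
    -- drawn inside `l`.
    have hx : (x : B) * σ adj.e = σ ((α : B →+* B) adj.e) * x := x.2 adj.e
    rw [h1, ← Finset.sum_mul, ← Finset.mul_sum, hfy.sum_eq, mul_one, ← map_mul, ← adj.e_rel_assoc,
      ← map_mul l (σ _), ← mul_assoc (σ _), ← hx, mul_assoc (x : B), adj.map_e_mul_m, mul_one,
      ← map_mul, map_mul l, adj.e_rel_assoc]

theorem Le.refl (σ : B →+* B) : Le σ σ :=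
  ⟨Unit, inferInstance, fun _ => 1, fun _ => 1, fun _ a => by simp, fun _ a => by simp, by simp⟩

end FieldAlgebraOfHom

end FieldAlg

theorem mainTheorem7 {B : Type u} [Ring B] (σ σl : B →+* B)
    (hσ : FieldAlg.IsMonoid σ)
    (adj : FieldAlg.Adj σl σ)
    (hσl : σl ∈ FieldAlg.fusionCat σ hσ) :
    FieldAlg.IsSplit
      (FieldAlg.FieldAlgebra.extension (FieldAlg.homFunctor σ (FieldAlg.fusionCat σ hσ))) ∧
    ∃ K : FieldAlg.LeftBialgebroid (FieldAlg.End σ) (FieldAlg.End (σ.comp σl)),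
      FieldAlg.IsEndBialgebroid adj K ∧
      (∃ M : FieldAlg.RightComoduleAlgebra K
          (FieldAlg.FieldAlgebra (FieldAlg.homFunctor σ (FieldAlg.fusionCat σ hσ))),
        FieldAlg.IsFieldCoaction adj (FieldAlg.fusionCat σ hσ) M ∧
        M.IsGalois
          (FieldAlg.FieldAlgebra.extension
            (FieldAlg.homFunctor σ (FieldAlg.fusionCat σ hσ)))) ∧
      FieldAlg.IsSplit K.s := by
  have hσC : σ ∈ FieldAlg.fusionCat σ hσ := FieldAlg.Le.refl σ
  have hC : σl.comp σ ∈ FieldAlg.fusionCat σ hσ := mul_mem hσl hσC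
  -- The only place where a summand diagram for `σlσ` is chosen; it exists because the endomorphisms
  -- below `σ` are closed under composition.
  obtain ⟨ι, _, p, q, hpq⟩ : FieldAlg.Le ((σ.comp σl).comp σ) σ :=
    mul_mem (S := Submonoid (B →+* B)) (mul_mem hσC hσl) hσC
  exact ⟨FieldAlg.extension_isSplit hσ.one_le adj _ hC, adj.endBialgebroid hpq,
    adj.isEndBialgebroid hpq,
    ⟨adj.comoduleAlgebra (FieldAlg.evalEquiv_baseMap adj _ hC) hpq,
      FieldAlg.isFieldCoaction adj _ hC hpq,
      adj.comoduleAlgebra_isGalois hpq _ (FieldAlg.evalEquiv_extension adj _ hC) hσ.one_le⟩,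
    adj.sourceHom_isSplit hσ.one_le⟩
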